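/- Let $\sigma>0$, $\rho>0$ and $\alpha\in(0,\infty)$ be fixed, and let $d,h\to\infty$ along a sequence with $d/h\to\alpha$. Model. For $\Phi\in\mathbb{R}^{h\times d}$ and $W\in\mathbb{R}^{h\times h}$ consider the cosine loss with stop gradient $$\mathcal{L}(\Phi,W;\bar\Phi)=\mathbb{E}_{x_0}\mathbb{E}_{x,x'\mid x_0}\left[-\frac{\langle W\Phi x,\bar\Phi x'\rangle}{\|W\Phi x\|_2\,\|\bar\Phi x'\|_2}\right],$$ where $x_0\sim\mathcal{N}(0,I_d)$ and, given $x_0$, the views $x,x'$ are independent with law $\mathcal{N}(x_0,\sigma^2I_d)$; gradients are taken in $(\Phi,W)$ with $\bar\Phi$ held fixed, and then $\bar\Phi=\Phi$ is substituted. With the weight decay $R(\Phi,W)=\frac{\rho}{2}(\|\Phi\|_F^2+\|W\|_F^2)$, the parameters follow the gradient flow $$\dot\Phi=-\nabla_\Phi\{\mathcal{L}+R\},\qquad \dot W=-\nabla_W\{\mathcal{L}+R\},$$ where either $W$ ranges over all $h\times h$ matrices, or $W$ is constrained to the space of symmetric $h\times h$ matrices (and $\nabla_W$ is the gradient on that space).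 Initialization. $\sqrt d\,\Phi(0)_{ij}\sim\mathcal{N}(0,1)$ for all $i,j$, and $\sqrt h\,W(0)_{ij}\sim\mathcal{N}(0,1)$ for all $i,j$. Either all entries of $W(0)$ are independent, or $W(0)$ is symmetric and its entries on and above the diagonal are independent (only the second option is possible for the symmetric flow once $h\ge 2$). Moreover $x_0\sim\mathcal{N}(0,I_d)$, and the entries of $\Phi(0)$, these independent entries of $W(0)$ and the coordinates of $x_0$ are jointly independent. Claim. Let $t\ge 0$ be fixed and let $(\Phi(s),W(s))_{0\le s\le t}$ be trajectories which, with probability tending to one (in particular, if almost surely), are solutions of the gradient flow on $[0,t]$. Then, with $\Psi=W\Phi$, $$\left\|\tfrac{1}{\sqrt{h\sigma^2}}\Phi(t)x_0\right\|_2=\left\|\tfrac{1}{\sqrt{h\sigma^2}}\Phi(t)\right\|_F+o_{\mathbb{P}}(1),\qquad \left\|\tfrac{1}{\sqrt{h^2\sigma^2}}\Psi(t)x_0\right\|_2=\left\|\tfrac{1}{\sqrt{h^2\sigma^2}}\Psi(t)\right\|_F+o_{\mathbb{P}}(1),$$ where $o_{\mathbb{P}}(1)$ denotes a sequence of random variables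 tending to $0$ in probability. -/

import Mathlib

open MeasureTheory ProbabilityTheory Filter Topology Matrix

/-- Euclidean norm of a vector. -/
noncomputable def l2Norm {k : ℕ} (v : Fin k → ℝ) : ℝ := ‖WithLp.toLp 2 v‖

/-- Frobenius inner product of two real matrices. -/
def frobInner {m k : ℕ} (A B : Matrix (Fin m) (Fin k) ℝ) : ℝ := ∑ i, ∑ j, A i j * B i j

/-- Frobenius norm of a real matrix. -/
noncomputable def frobNorm {m k : ℕ} (A : Matrix (Fin m) (Fin k) ℝ) : ℝ :=
  Real.sqrt (frobInner A A)

/-- The space of symmetric `h × h` real matrices. -/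
def symMatrices (h : ℕ) : Submodule ℝ (Matrix (Fin h) (Fin h) ℝ) where
  carrier := {A | A.IsSymm}
  add_mem' := fun hA hB => Matrix.IsSymm.add hA hB
  zero_mem' := Matrix.isSymm_zero
  smul_mem' := fun c _ hA => Matrix.IsSymm.smul hA c

/-- The Gaussian measure `N(μ, σ² I)` on `ℝᵈ`. -/
noncomputable def isoGaussian {d : ℕ} (μ : Fin d → ℝ) (σ : ℝ) : Measure (Fin d → ℝ) :=
  Measure.pi fun i => gaussianReal (μ i) (Real.toNNReal (σ ^ 2))

/-- The cosine loss with the target branch frozen at `Φbar` (the stop-gradient copy of `Φ`):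
the anchor is `x₀ ∼ N(0, I)`, and the two views `x`, `x'` are, given `x₀`, independent draws from
`N(x₀, σ² I)`. -/
noncomputable def cosLoss {d h : ℕ} (σ : ℝ) (Φ : Matrix (Fin h) (Fin d) ℝ)
    (W : Matrix (Fin h) (Fin h) ℝ) (Φbar : Matrix (Fin h) (Fin d) ℝ) : ℝ :=
  ∫ x₀, ∫ x, ∫ x',
      -((((W * Φ) *ᵥ x) ⬝ᵥ (Φbar *ᵥ x')) / (l2Norm ((W * Φ) *ᵥ x) * l2Norm (Φbar *ᵥ x')))
    ∂(isoGaussian x₀ σ) ∂(isoGaussian x₀ σ) ∂(isoGaussian (0 : Fin d → ℝ) 1)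

/-- The cosine loss (target branch frozen at `Φbar`) plus the weight decay
`(ρ / 2) (‖Φ‖_F² + ‖W‖_F²)`. -/
noncomputable def regLoss {d h : ℕ} (σ ρ : ℝ) (Φ : Matrix (Fin h) (Fin d) ℝ)
    (W : Matrix (Fin h) (Fin h) ℝ) (Φbar : Matrix (Fin h) (Fin d) ℝ) : ℝ :=
  cosLoss σ Φ W Φbar + ρ / 2 * (frobNorm Φ ^ 2 + frobNorm W ^ 2)

/-- `G` is the gradient at `A`, for the Frobenius inner product, of the restriction of `f` to the
linear space `S` of matrices. -/
def IsGradOn {m k : ℕ} (f : Matrix (Fin m) (Fin k) ℝ → ℝ)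
    (S : Submodule ℝ (Matrix (Fin m) (Fin k) ℝ)) (A G : Matrix (Fin m) (Fin k) ℝ) : Prop :=
  G ∈ S ∧ ∃ L : Matrix (Fin m) (Fin k) ℝ →L[ℝ] ℝ,
    HasFDerivWithinAt f L (S : Set (Matrix (Fin m) (Fin k) ℝ)) A ∧
      ∀ B ∈ S, L B = frobInner G B

/-- On the time interval `[0, T]`, the pair `(Φ, W)` is a gradient flow of the regularised cosine
loss with stop gradient, the projection head ranging over the linear space `S`. For `S = ⊤` this is
the unconstrained flow; for `S = symMatrices h` the head is a symmetric matrix at all times. -/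
def IsGradientFlow {d h : ℕ} (σ ρ : ℝ) (S : Submodule ℝ (Matrix (Fin h) (Fin h) ℝ)) (T : ℝ)
    (Φ : ℝ → Matrix (Fin h) (Fin d) ℝ) (W : ℝ → Matrix (Fin h) (Fin h) ℝ) : Prop :=
  ∀ s ∈ Set.Icc 0 T, W s ∈ S ∧
    ∃ (GΦ : Matrix (Fin h) (Fin d) ℝ) (GW : Matrix (Fin h) (Fin h) ℝ),
      IsGradOn (fun A => regLoss σ ρ A (W s) (Φ s)) ⊤ (Φ s) GΦ ∧
      IsGradOn (fun B => regLoss σ ρ (Φ s) B (Φ s)) S (W s) GW ∧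
      HasDerivWithinAt Φ (-GΦ) (Set.Icc 0 T) s ∧
      HasDerivWithinAt W (-GW) (Set.Icc 0 T) s

/-- `x₀ ∼ N(0, I_d)`, `√d Φ_{ij} ∼ N(0, 1)`, `√h W_{ij} ∼ N(0, 1)`, and the family consisting of all
the entries of `Φ`, the entries of `W` with positions in `I`, and all the coordinates of `x₀` is
independent. -/
structure IsGaussianInit {Ω : Type*} [MeasurableSpace Ω] (P : Measure Ω) {d h : ℕ}
    (I : Set (Fin h × Fin h)) (Φ : Ω → Matrix (Fin h) (Fin d) ℝ)
    (W : Ω → Matrix (Fin h) (Fin h) ℝ) (x₀ : Ω → Fin d → ℝ) : Prop where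
  law_Φ : ∀ i j, HasLaw (fun ω => Real.sqrt d * Φ ω i j) (gaussianReal 0 1) P
  law_W : ∀ i j, HasLaw (fun ω => Real.sqrt h * W ω i j) (gaussianReal 0 1) P
  law_x₀ : ∀ j, HasLaw (fun ω => x₀ ω j) (gaussianReal 0 1) P
  indep : iIndepFun
    (Sum.elim (fun (p : Fin h × Fin d) ω => Φ ω p.1 p.2)
      (Sum.elim (fun (q : I) ω => W ω q.1.1 q.1.2) (fun (j : Fin d) ω => x₀ ω j))) P

/-- All the entries of `Φ`, `W` and `x₀` are independent. -/
def IsIIDInit {Ω : Type*} [MeasurableSpace Ω] (P : Measure Ω) {d h : ℕ}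
    (Φ : Ω → Matrix (Fin h) (Fin d) ℝ) (W : Ω → Matrix (Fin h) (Fin h) ℝ)
    (x₀ : Ω → Fin d → ℝ) : Prop :=
  IsGaussianInit P Set.univ Φ W x₀

/-- `W` is symmetric, and independence holds for its entries on and above the diagonal. -/
def IsSymmetricInit {Ω : Type*} [MeasurableSpace Ω] (P : Measure Ω) {d h : ℕ}
    (Φ : Ω → Matrix (Fin h) (Fin d) ℝ) (W : Ω → Matrix (Fin h) (Fin h) ℝ)
    (x₀ : Ω → Fin d → ℝ) : Prop :=
  (∀ᵐ ω ∂P, (W ω).IsSymm) ∧ IsGaussianInit P {q | q.1 ≤ q.2} Φ W x₀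

/-- `X n = o_P(1)`: convergence to `0` in probability, `X n` living on its own space. -/
def IsLittleOP {Ω : ℕ → Type*} [∀ n, MeasurableSpace (Ω n)] (P : ∀ n, Measure (Ω n))
    (X : ∀ n, Ω n → ℝ) : Prop :=
  ∀ ε : ℝ, 0 < ε → Tendsto (fun n => P n {ω | ε ≤ |X n ω|}) atTop (𝓝 0)

/-! The loss gradient is of order `1 / √h` in Frobenius norm at a typical initialization, whereas
the operator norms of `Φ` and `W` stay bounded. Up to the scalar factor `exp (-ρ s)` produced by the
weight decay, the parameters therefore barely move on a fixed time interval, and the claim reduces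
to facts about the initial matrices.

Gradient bound. Cosine similarity satisfies `|cosSim u v - cosSim w v| ≤ 2 |u - w| / |u|`. Averaging
over the Gaussian views and applying Cauchy–Schwarz, the loss is Lipschitz in `W Φ` with a constant
governed by the inverse second moment of a Gaussian vector `A g`, `A = W Φ`. Integration by parts
bounds that moment by `1 / (‖A‖_F² - 2 ‖A‖²)` (`integral_inv_vecNorm_sq_add_le`,
`abs_cosLoss_sub_le`). Since `‖W Φ‖_F` is of order `√h` and `‖W Φ‖` is bounded, the constant is `O(1
/ √h)`. A gradient supplied by the flow is bounded by the Lipschitz constant, on any linear space of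
heads (`matNorm_grad_sub_le`). A barrier argument for `exp (ρ s) Φ(s)` and `exp (ρ s) W(s)` keeps
them within any prescribed distance of their initial values for large `h`
(`IsGradientFlow.matNorm_exp_smul_sub_le`).

Concentration. The same inverse moment shows that `|A g|` lies within `O(‖A‖)` of `‖A‖_F` in mean
square (`lintegral_vecNorm_sub_matNorm_sq_le`). Conditionally on `Φ(0)`, this controls `|Φ(0) x₀| -
‖Φ(0)‖_F`; applied to left multiplication by `W(0)`, it bounds `‖W(0) Φ(0)‖_F` from below. Operator
norms are bounded by nets and sub-Gaussian tails.

The statement on `Φ(t)` follows because both norms are Lipschitz in the matrix. The statement on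
`Ψ(t)` needs no cancellation: both terms are `O(√d)`, negligible against the normalization `h`. -/

section LinearAlgebra

/-! ### Euclidean, Frobenius and operator norms. -/

variable {ι κ μ : Type*} [Fintype ι] [Fintype κ] [Fintype μ]

/-- Euclidean norm of a vector over an arbitrary finite index type. -/
noncomputable def vecNorm (v : ι → ℝ) : ℝ := ‖WithLp.toLp 2 v‖

/-- Frobenius norm of a matrix over arbitrary finite index types. -/
noncomputable def matNorm (A : Matrix κ ι ℝ) : ℝ := vecNorm fun p : κ × ι => A p.1 p.2

/-- Operator norm of a matrix for the Euclidean norms. -/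
noncomputable def opNorm (A : Matrix κ ι ℝ) : ℝ := by
  classical exact ‖(toEuclideanLin A).toContinuousLinearMap‖

lemma vecNorm_sq (v : ι → ℝ) : vecNorm v ^ 2 = ∑ i, v i ^ 2 :=
  EuclideanSpace.real_norm_sq_eq _

lemma vecNorm_sq_eq_dotProduct (v : ι → ℝ) : vecNorm v ^ 2 = v ⬝ᵥ v := by
  rw [vecNorm_sq]; simp [dotProduct, sq]

lemma vecNorm_nonneg (v : ι → ℝ) : 0 ≤ vecNorm v := norm_nonneg _

lemma vecNorm_zero : vecNorm (0 : ι → ℝ) = 0 := norm_zero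

lemma vecNorm_eq_zero {v : ι → ℝ} : vecNorm v = 0 ↔ v = 0 := by
  simp [vecNorm]

lemma vecNorm_add_le (v w : ι → ℝ) : vecNorm (v + w) ≤ vecNorm v + vecNorm w :=
  norm_add_le (WithLp.toLp 2 v) (WithLp.toLp 2 w)

lemma vecNorm_smul (c : ℝ) (v : ι → ℝ) : vecNorm (c • v) = |c| * vecNorm v :=
  norm_smul c (WithLp.toLp 2 v)

lemma vecNorm_neg (v : ι → ℝ) : vecNorm (-v) = vecNorm v :=
  norm_neg (WithLp.toLp 2 v)

lemma vecNorm_sub_comm (v w : ι → ℝ) : vecNorm (v - w) = vecNorm (w - v) := by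
  rw [← vecNorm_neg, neg_sub]

lemma abs_dotProduct_le (v w : ι → ℝ) : |v ⬝ᵥ w| ≤ vecNorm v * vecNorm w := by
  have := abs_real_inner_le_norm (WithLp.toLp 2 w) (WithLp.toLp 2 v)
  simpa [EuclideanSpace.inner_toLp_toLp, vecNorm, mul_comm] using this

lemma continuous_vecNorm : Continuous (vecNorm : (ι → ℝ) → ℝ) :=
  continuous_norm.comp (PiLp.continuous_toLp 2 _)

lemma abs_vecNorm_sub_le (v w : ι → ℝ) : |vecNorm v - vecNorm w| ≤ vecNorm (v - w) :=
  abs_norm_sub_norm_le (WithLp.toLp 2 v) (WithLp.toLp 2 w)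

lemma matNorm_sq (A : Matrix κ ι ℝ) : matNorm A ^ 2 = ∑ i, ∑ j, A i j ^ 2 := by
  rw [matNorm, vecNorm_sq, Fintype.sum_prod_type]

lemma matNorm_nonneg (A : Matrix κ ι ℝ) : 0 ≤ matNorm A := norm_nonneg _

lemma matNorm_add_le (A B : Matrix κ ι ℝ) : matNorm (A + B) ≤ matNorm A + matNorm B :=
  vecNorm_add_le (fun p : κ × ι => A p.1 p.2) (fun p : κ × ι => B p.1 p.2)

lemma matNorm_smul (c : ℝ) (A : Matrix κ ι ℝ) : matNorm (c • A) = |c| * matNorm A :=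
  vecNorm_smul c (fun p : κ × ι => A p.1 p.2)

lemma matNorm_neg (A : Matrix κ ι ℝ) : matNorm (-A) = matNorm A :=
  vecNorm_neg (fun p : κ × ι => A p.1 p.2)

lemma matNorm_sub_comm (A B : Matrix κ ι ℝ) : matNorm (A - B) = matNorm (B - A) := by
  rw [← matNorm_neg, neg_sub]

lemma abs_matNorm_sub_le (A B : Matrix κ ι ℝ) : |matNorm A - matNorm B| ≤ matNorm (A - B) :=
  abs_vecNorm_sub_le (fun p : κ × ι => A p.1 p.2) (fun p : κ × ι => B p.1 p.2)

lemma matNorm_transpose (A : Matrix κ ι ℝ) : matNorm Aᵀ = matNorm A := by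
  have : matNorm Aᵀ ^ 2 = matNorm A ^ 2 := by
    rw [matNorm_sq, matNorm_sq, Finset.sum_comm]; rfl
  exact (pow_left_inj₀ (matNorm_nonneg _) (matNorm_nonneg _) two_ne_zero).1 this

lemma matNorm_sq_eq_sum_rows (A : Matrix κ ι ℝ) : matNorm A ^ 2 = ∑ i, vecNorm (A i) ^ 2 := by
  simp_rw [matNorm_sq, vecNorm_sq]

lemma matNorm_sq_eq_sum_cols (A : Matrix κ ι ℝ) :
    matNorm A ^ 2 = ∑ j, vecNorm (fun i => A i j) ^ 2 := by
  rw [← matNorm_transpose, matNorm_sq_eq_sum_rows]; rfl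

lemma vecNorm_mulVec_le_matNorm (A : Matrix κ ι ℝ) (v : ι → ℝ) :
    vecNorm (A *ᵥ v) ≤ matNorm A * vecNorm v := by
  refine abs_le_of_sq_le_sq' ?_ (mul_nonneg (matNorm_nonneg _) (vecNorm_nonneg _)) |>.2
  rw [mul_pow, matNorm_sq_eq_sum_rows, vecNorm_sq, Finset.sum_mul]
  refine Finset.sum_le_sum fun i _ => ?_
  rw [← mul_pow, ← sq_abs ((A *ᵥ v) i)]
  exact pow_le_pow_left₀ (abs_nonneg _) (abs_dotProduct_le _ _) 2

lemma opNorm_nonneg (A : Matrix κ ι ℝ) : 0 ≤ opNorm A := norm_nonneg _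

lemma vecNorm_mulVec_le (A : Matrix κ ι ℝ) (v : ι → ℝ) :
    vecNorm (A *ᵥ v) ≤ opNorm A * vecNorm v := by
  classical
  exact (toEuclideanLin A).toContinuousLinearMap.le_opNorm (WithLp.toLp 2 v)

lemma opNorm_le {A : Matrix κ ι ℝ} {M : ℝ} (hM : 0 ≤ M)
    (h : ∀ v, vecNorm (A *ᵥ v) ≤ M * vecNorm v) : opNorm A ≤ M := by
  classical
  exact ContinuousLinearMap.opNorm_le_bound _ hM fun v => h v.ofLp

lemma opNorm_le_matNorm (A : Matrix κ ι ℝ) : opNorm A ≤ matNorm A :=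
  opNorm_le (matNorm_nonneg _) (vecNorm_mulVec_le_matNorm A)

lemma opNorm_add_le (A B : Matrix κ ι ℝ) : opNorm (A + B) ≤ opNorm A + opNorm B := by
  refine opNorm_le (add_nonneg (opNorm_nonneg _) (opNorm_nonneg _)) fun v => ?_
  rw [add_mulVec, add_mul]
  exact (vecNorm_add_le _ _).trans (add_le_add (vecNorm_mulVec_le _ _) (vecNorm_mulVec_le _ _))

lemma opNorm_smul_le (c : ℝ) (A : Matrix κ ι ℝ) : opNorm (c • A) ≤ |c| * opNorm A := by
  refine opNorm_le (mul_nonneg (abs_nonneg _) (opNorm_nonneg _)) fun v => ?_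
  rw [smul_mulVec, vecNorm_smul, mul_assoc]
  exact mul_le_mul_of_nonneg_left (vecNorm_mulVec_le _ _) (abs_nonneg _)

lemma opNorm_mul_le (A : Matrix κ ι ℝ) (B : Matrix ι μ ℝ) :
    opNorm (A * B) ≤ opNorm A * opNorm B := by
  refine opNorm_le (mul_nonneg (opNorm_nonneg _) (opNorm_nonneg _)) fun v => ?_
  rw [← mulVec_mulVec, mul_assoc]
  exact (vecNorm_mulVec_le _ _).trans
    (mul_le_mul_of_nonneg_left (vecNorm_mulVec_le _ _) (opNorm_nonneg _))

/-- Duality: `|Aᵀ v|² = ⟨A Aᵀ v, v⟩ ≤ ‖A‖ |Aᵀ v| |v|`, then divide by `|Aᵀ v|`. -/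
lemma opNorm_transpose_le (A : Matrix κ ι ℝ) : opNorm Aᵀ ≤ opNorm A := by
  refine opNorm_le (opNorm_nonneg _) fun v => ?_
  rcases (vecNorm_nonneg (Aᵀ *ᵥ v)).eq_or_lt with h | h
  · rw [← h]; exact mul_nonneg (opNorm_nonneg _) (vecNorm_nonneg _)
  · refine le_of_mul_le_mul_left ?_ h
    calc vecNorm (Aᵀ *ᵥ v) * vecNorm (Aᵀ *ᵥ v) = (A *ᵥ (Aᵀ *ᵥ v)) ⬝ᵥ v := by
          rw [← sq, vecNorm_sq_eq_dotProduct, mulVec_transpose, ← dotProduct_mulVec,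
            dotProduct_comm]
      _ ≤ vecNorm (A *ᵥ (Aᵀ *ᵥ v)) * vecNorm v := (le_abs_self _).trans (abs_dotProduct_le _ _)
      _ ≤ opNorm A * vecNorm (Aᵀ *ᵥ v) * vecNorm v :=
          mul_le_mul_of_nonneg_right (vecNorm_mulVec_le _ _) (vecNorm_nonneg _)
      _ = _ := by ring

lemma opNorm_transpose (A : Matrix κ ι ℝ) : opNorm Aᵀ = opNorm A :=
  (opNorm_transpose_le A).antisymm (by simpa using opNorm_transpose_le Aᵀ)

lemma continuous_opNorm : Continuous (opNorm : Matrix κ ι ℝ → ℝ) := by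
  classical
  have : Continuous fun A : Matrix κ ι ℝ =>
      ((toEuclideanLin (𝕜 := ℝ)).trans LinearMap.toContinuousLinearMap) A :=
    LinearMap.continuous_of_finiteDimensional
      ((toEuclideanLin (𝕜 := ℝ) (m := κ) (n := ι)).trans LinearMap.toContinuousLinearMap).toLinearMap
  exact this.norm

lemma continuous_matNorm : Continuous (matNorm : Matrix κ ι ℝ → ℝ) :=
  continuous_vecNorm.comp (by fun_prop)

lemma matNorm_mul_le_left (A : Matrix κ ι ℝ) (B : Matrix ι μ ℝ) :
    matNorm (A * B) ≤ opNorm A * matNorm B := by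
  refine abs_le_of_sq_le_sq' ?_ (mul_nonneg (opNorm_nonneg _) (matNorm_nonneg _)) |>.2
  rw [mul_pow, matNorm_sq_eq_sum_cols, matNorm_sq_eq_sum_cols, Finset.mul_sum]
  refine Finset.sum_le_sum fun j _ => ?_
  rw [← mul_pow]
  exact pow_le_pow_left₀ (vecNorm_nonneg _) (vecNorm_mulVec_le A fun i => B i j) 2

lemma matNorm_mul_le_right (A : Matrix κ ι ℝ) (B : Matrix ι μ ℝ) :
    matNorm (A * B) ≤ matNorm A * opNorm B := by
  rw [← matNorm_transpose, transpose_mul, ← matNorm_transpose A, ← opNorm_transpose B, mul_comm]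
  exact matNorm_mul_le_left _ _

/-- Each column is the image of a unit vector, so its length is at most the operator norm. -/
lemma matNorm_sq_le_card_mul (A : Matrix κ ι ℝ) :
    matNorm A ^ 2 ≤ Fintype.card ι * opNorm A ^ 2 := by
  classical
  rw [matNorm_sq_eq_sum_cols]
  calc _ ≤ ∑ _j : ι, opNorm A ^ 2 := by
        refine Finset.sum_le_sum fun j _ => pow_le_pow_left₀ (vecNorm_nonneg _) ?_ 2
        have h1 : vecNorm (Pi.single j (1 : ℝ)) = 1 := by
          rw [← pow_left_inj₀ (vecNorm_nonneg _) zero_le_one two_ne_zero, vecNorm_sq]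
          simp [Pi.single_apply]
        have h := vecNorm_mulVec_le A (Pi.single j 1)
        rwa [h1, mul_one, mulVec_single_one] at h
    _ = _ := by simp

lemma l2Norm_eq_vecNorm {k : ℕ} (v : Fin k → ℝ) : l2Norm v = vecNorm v := rfl

lemma frobInner_self {m k : ℕ} (A : Matrix (Fin m) (Fin k) ℝ) :
    frobInner A A = matNorm A ^ 2 := by
  rw [matNorm_sq]; simp [frobInner, sq]

lemma frobNorm_eq_matNorm {m k : ℕ} (A : Matrix (Fin m) (Fin k) ℝ) :
    frobNorm A = matNorm A := by
  rw [frobNorm, frobInner_self, Real.sqrt_sq (matNorm_nonneg A)]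

end LinearAlgebra

/-! ### Gaussian integration by parts and second moments. -/

section Gaussian

/-- The standard Gaussian measure on `ι → ℝ`. -/
noncomputable abbrev stdGauss (ι : Type*) [Fintype ι] : Measure (ι → ℝ) :=
  Measure.pi fun _ => gaussianReal 0 1

lemma integrable_gaussianReal_iff {f : ℝ → ℝ} :
    Integrable f (gaussianReal 0 1) ↔ Integrable fun x => gaussianPDFReal 0 1 x * f x := by
  rw [gaussianReal_of_var_ne_zero _ one_ne_zero,
    integrable_withDensity_iff_integrable_smul₀' (measurable_gaussianPDF 0 1).aemeasurable
      (ae_of_all _ fun x => gaussianPDF_lt_top)]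
  simp [toReal_gaussianPDF]

lemma hasDerivAt_gaussianPDFReal (x : ℝ) :
    HasDerivAt (gaussianPDFReal 0 1) (-x * gaussianPDFReal 0 1 x) x := by
  have h : HasDerivAt (fun x : ℝ => -(x - 0) ^ 2 / (2 * (1 : ℝ))) (-x) x := by
    have := (((hasDerivAt_id' x).sub_const 0).pow 2).neg.div_const (2 * (1 : ℝ))
    refine this.congr_deriv ?_
    norm_num
    ring
  have := h.exp.const_mul ((√(2 * Real.pi * (1 : ℝ)))⁻¹)
  refine this.congr_deriv ?_
  simp only [gaussianPDFReal, NNReal.coe_one]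
  ring

/-- Gaussian integration by parts on the line. -/
lemma integral_deriv_gaussianReal {f f' : ℝ → ℝ} (hf : ∀ x, HasDerivAt f (f' x) x)
    (h0 : Integrable f (gaussianReal 0 1)) (h1 : Integrable f' (gaussianReal 0 1))
    (h2 : Integrable (fun x => x * f x) (gaussianReal 0 1)) :
    ∫ x, f' x ∂gaussianReal 0 1 = ∫ x, x * f x ∂gaussianReal 0 1 := by
  rw [integrable_gaussianReal_iff] at h0 h1 h2
  rw [integral_gaussianReal_eq_integral_smul one_ne_zero,
    integral_gaussianReal_eq_integral_smul one_ne_zero]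
  have := integral_mul_deriv_eq_deriv_mul_of_integrable (u := gaussianPDFReal 0 1) (v := f)
    (fun x _ => hasDerivAt_gaussianPDFReal x) (fun x _ => hf x) h1
    (by refine h2.neg.congr (ae_of_all _ fun x => ?_); simp; ring) h0
  simp only [smul_eq_mul]
  rw [this, ← integral_neg]
  congr 1; ext x; ring

variable {ι κ : Type*} [Fintype ι]

/-- Resampling one coordinate leaves the product measure invariant. This isolates a single variable
for Fubini, so that the one-dimensional integration by parts can be applied to it. -/
lemma measurePreserving_update [DecidableEq ι] (i : ι) :
    MeasurePreserving (fun p : (ι → ℝ) × ℝ => Function.update p.1 i p.2)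
      ((stdGauss ι).prod (gaussianReal 0 1)) (stdGauss ι) := by
  have hm : Measurable fun p : (ι → ℝ) × ℝ => Function.update p.1 i p.2 :=
    measurable_pi_iff.2 fun j => by
      by_cases h : j = i
      · subst h; simpa using measurable_snd
      · simp only [Function.update_of_ne h]; fun_prop
  refine ⟨hm, (Measure.pi_eq fun s hs => ?_).symm⟩
  rw [Measure.map_apply hm (.univ_pi hs)]
  have : (fun p : (ι → ℝ) × ℝ => Function.update p.1 i p.2) ⁻¹' Set.univ.pi s =
      (Set.univ.pi (Function.update s i Set.univ)) ×ˢ s i := by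
    ext ⟨g, x⟩
    simp only [Set.mem_preimage, Set.mem_univ_pi, Set.mem_prod]
    constructor
    · refine fun h => ⟨fun j => ?_, by simpa using h i⟩
      by_cases hj : j = i
      · subst hj; simp
      · simpa [Function.update_of_ne hj] using h j
    · rintro ⟨h, hx⟩ j
      by_cases hj : j = i
      · subst hj; simpa using hx
      · simpa [Function.update_of_ne hj] using h j
  rw [this, Measure.prod_prod, Measure.pi_pi, ← Finset.mul_prod_erase _ _ (Finset.mem_univ i),
    ← Finset.mul_prod_erase Finset.univ (fun j => gaussianReal 0 1 (s j)) (Finset.mem_univ i)]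
  simp only [Function.update_self, measure_univ, one_mul]
  rw [mul_comm]
  congr 1
  exact Finset.prod_congr rfl fun j hj => by rw [Function.update_of_ne (Finset.ne_of_mem_erase hj)]

/-- Gaussian integration by parts in one coordinate. -/
lemma integral_partial_stdGauss [DecidableEq ι] (i : ι) {F F' : (ι → ℝ) → ℝ}
    (hF : ∀ g x, HasDerivAt (fun y => F (Function.update g i y)) (F' (Function.update g i x)) x)
    (h0 : Integrable F (stdGauss ι)) (h1 : Integrable F' (stdGauss ι))
    (h2 : Integrable (fun g => g i * F g) (stdGauss ι)) :
    ∫ g, F' g ∂stdGauss ι = ∫ g, g i * F g ∂stdGauss ι := by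
  have hp := measurePreserving_update i
  have key : ∀ {G : (ι → ℝ) → ℝ}, Integrable G (stdGauss ι) →
      Integrable (fun p : (ι → ℝ) × ℝ => G (Function.update p.1 i p.2))
        ((stdGauss ι).prod (gaussianReal 0 1)) ∧
      ∫ g, G g ∂stdGauss ι = ∫ g, ∫ x, G (Function.update g i x) ∂gaussianReal 0 1 ∂stdGauss ι := by
    intro G hG
    have hi : Integrable (fun p : (ι → ℝ) × ℝ => G (Function.update p.1 i p.2))
        ((stdGauss ι).prod (gaussianReal 0 1)) := hp.integrable_comp_of_integrable hG
    refine ⟨hi, ?_⟩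
    rw [← integral_prod _ hi]
    conv_lhs => rw [← hp.map_eq]
    rw [integral_map hp.measurable.aemeasurable (hp.map_eq.symm ▸ hG.aestronglyMeasurable)]
  obtain ⟨i0, -⟩ := key h0
  obtain ⟨i1, e1⟩ := key h1
  obtain ⟨i2, e2⟩ := key h2
  rw [e1, e2]
  refine integral_congr_ae ?_
  filter_upwards [i0.prod_right_ae, i1.prod_right_ae, i2.prod_right_ae] with g a0 a1 a2
  simp only [Function.update_self] at a2 ⊢
  exact integral_deriv_gaussianReal (hF g) a0 a1 a2

lemma memLp_eval_stdGauss (i : ι) (p : NNReal) :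
    MemLp (fun g : ι → ℝ => g i) p (stdGauss ι) :=
  (memLp_id_gaussianReal p).comp_measurePreserving (measurePreserving_eval _ i)

lemma integrable_eval_stdGauss (i : ι) : Integrable (fun g : ι → ℝ => g i) (stdGauss ι) :=
  memLp_one_iff_integrable.1 (by simpa using memLp_eval_stdGauss i 1)

lemma integrable_eval_mul_eval_stdGauss (i j : ι) :
    Integrable (fun g : ι → ℝ => g i * g j) (stdGauss ι) :=
  MemLp.integrable_mul (p := 2) (q := 2) (memLp_eval_stdGauss i 2) (memLp_eval_stdGauss j 2)

lemma sum_eval_mul_mulVec [Fintype κ] (A : Matrix κ ι ℝ) (g : ι → ℝ) :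
    ∑ i, g i * ((Aᵀ * A) *ᵥ g) i = vecNorm (A *ᵥ g) ^ 2 := by
  rw [vecNorm_sq_eq_dotProduct, ← mulVec_mulVec]
  change g ⬝ᵥ _ = _
  rw [dotProduct_mulVec, vecMul_transpose]

lemma sum_diag_transpose_mul [Fintype κ] (A : Matrix κ ι ℝ) : ∑ i, (Aᵀ * A) i i = matNorm A ^ 2 := by
  rw [matNorm_sq, Finset.sum_comm]
  simp [mul_apply, sq]

lemma update_eq_add_single {ι : Type*} [DecidableEq ι] (g : ι → ℝ) (i : ι) (y : ℝ) :
    Function.update g i y = g + (y - g i) • Pi.single i 1 := by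
  ext j
  by_cases h : j = i
  · subst h; simp
  · simp [h]

lemma hasDerivAt_mulVec_update [DecidableEq ι] (B : Matrix κ ι ℝ) (g : ι → ℝ) (i : ι) (k : κ)
    (x : ℝ) : HasDerivAt (fun y => (B *ᵥ Function.update g i y) k) (B k i) x := by
  simp_rw [update_eq_add_single, mulVec_add, mulVec_smul, mulVec_single_one]
  have := (((hasDerivAt_id x).sub_const (g i)).mul_const (B k i)).const_add ((B *ᵥ g) k)
  simpa using this

lemma integrable_eval_mul_mulVec (B : Matrix κ ι ℝ) (i : ι) (k : κ) :
    Integrable (fun g : ι → ℝ => g i * (B *ᵥ g) k) (stdGauss ι) := by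
  simp only [mulVec, dotProduct, Finset.mul_sum]
  refine integrable_finsetSum _ fun j _ => ?_
  simpa [mul_left_comm] using (integrable_eval_mul_eval_stdGauss i j).const_mul (B k j)

lemma integrable_mulVec (B : Matrix κ ι ℝ) (k : κ) :
    Integrable (fun g : ι → ℝ => (B *ᵥ g) k) (stdGauss ι) := by
  simp only [mulVec, dotProduct]
  exact integrable_finsetSum _ fun j _ => (integrable_eval_stdGauss j).const_mul _

lemma integrable_vecNorm_mulVec_sq [Fintype κ] (A : Matrix κ ι ℝ) :
    Integrable (fun g => vecNorm (A *ᵥ g) ^ 2) (stdGauss ι) := by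
  simp_rw [← sum_eval_mul_mulVec]
  exact integrable_finsetSum _ fun i _ => integrable_eval_mul_mulVec _ i i

/-- Integration by parts for the linear field `g ↦ Aᵀ A g`, whose divergence is the constant `tr (Aᵀ
A)`. -/
lemma integral_vecNorm_mulVec_sq [Fintype κ] (A : Matrix κ ι ℝ) :
    ∫ g, vecNorm (A *ᵥ g) ^ 2 ∂stdGauss ι = matNorm A ^ 2 := by
  classical
  simp_rw [← sum_eval_mul_mulVec]
  rw [integral_finsetSum _ fun i _ => integrable_eval_mul_mulVec _ i i, ← sum_diag_transpose_mul]
  refine Finset.sum_congr rfl fun i _ => ?_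
  rw [← integral_partial_stdGauss i (F' := fun _ => (Aᵀ * A) i i)
    (fun g x => hasDerivAt_mulVec_update _ g i i x) (integrable_mulVec _ _)
    (integrable_const _) (integrable_eval_mul_mulVec _ _ _)]
  simp

end Gaussian

/-! ### Inverse moments of `A g` and concentration of its norm. -/

section InverseMoment

variable {ι κ : Type*} [Fintype ι]

lemma continuous_mulVec (A : Matrix κ ι ℝ) : Continuous fun g : ι → ℝ => A *ᵥ g :=
  Continuous.matrix_mulVec continuous_const continuous_id

variable [Fintype κ]

lemma continuous_vecNorm_mulVec (A : Matrix κ ι ℝ) :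
    Continuous fun g : ι → ℝ => vecNorm (A *ᵥ g) :=
  continuous_vecNorm.comp (continuous_mulVec A)

lemma hasDerivAt_vecNorm_mulVec_sq_update [DecidableEq ι] (A : Matrix κ ι ℝ) (g : ι → ℝ) (i : ι)
    (x : ℝ) : HasDerivAt (fun y => vecNorm (A *ᵥ Function.update g i y) ^ 2)
      (2 * ((Aᵀ * A) *ᵥ Function.update g i x) i) x := by
  simp_rw [vecNorm_sq]
  refine (HasDerivAt.fun_sum fun k _ =>
    (hasDerivAt_mulVec_update A g i k x).fun_pow 2).congr_deriv ?_
  rw [← mulVec_mulVec]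
  simp only [mulVec, dotProduct, transpose_apply, Finset.mul_sum]
  refine Finset.sum_congr rfl fun k _ => ?_
  simp only [Nat.cast_ofNat, Nat.add_one_sub_one, pow_one, Finset.mul_sum, Finset.sum_mul]
  refine Finset.sum_congr rfl fun j _ => ?_
  ring

lemma abs_apply_le_vecNorm (v : ι → ℝ) (i : ι) : |v i| ≤ vecNorm v :=
  PiLp.norm_apply_le (WithLp.toLp 2 v) i

lemma vecNorm_gram_le (A : Matrix κ ι ℝ) (g : ι → ℝ) :
    vecNorm ((Aᵀ * A) *ᵥ g) ≤ opNorm A * vecNorm (A *ᵥ g) := by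
  rw [← mulVec_mulVec, ← opNorm_transpose]
  exact vecNorm_mulVec_le _ _

/-- Regularized inverse moment of a Gaussian quadratic form. -/
lemma integral_inv_vecNorm_sq_add_le (A : Matrix κ ι ℝ) {ε : ℝ} (hε : 0 < ε) :
    (matNorm A ^ 2 - 2 * opNorm A ^ 2) * ∫ g, (vecNorm (A *ᵥ g) ^ 2 + ε)⁻¹ ∂stdGauss ι ≤ 1 := by
  classical
  set q : (ι → ℝ) → ℝ := fun g => vecNorm (A *ᵥ g) ^ 2 with hq
  have hqc : Continuous q := (continuous_vecNorm_mulVec A).pow 2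
  have hq0 : ∀ g, 0 ≤ q g := fun g => sq_nonneg _
  have hpos : ∀ g, 0 < q g + ε := fun g => by linarith [hq0 g]
  set N := Aᵀ * A with hN
  have hNc : ∀ i, Continuous fun g : ι → ℝ => (N *ᵥ g) i := fun i =>
    (continuous_apply i).comp (continuous_mulVec N)
  -- Integration by parts is applied to the vector field `F = N g / (q + ε)`. Since `g · N g = q`,
  -- the pairing `g · F` is `q / (q + ε) ≤ 1`; the divergence is `tr N / (q + ε) - 2 |N g|² / (q +
  -- ε)²`, and `|N g|² ≤ ‖A‖² q` bounds it below by `(‖A‖_F² - 2 ‖A‖²) / (q + ε)`.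
  set F : ι → (ι → ℝ) → ℝ := fun i g => (N *ᵥ g) i * (q g + ε)⁻¹ with hF
  set F' : ι → (ι → ℝ) → ℝ := fun i g =>
    N i i * (q g + ε)⁻¹ - 2 * (N *ᵥ g) i ^ 2 * ((q g + ε)⁻¹) ^ 2 with hF'
  have hinvc : Continuous fun g => (q g + ε)⁻¹ :=
    (hqc.add continuous_const).inv₀ fun g => (hpos g).ne'
  have hFc : ∀ i, Continuous (F i) := fun i => (hNc i).mul hinvc
  have hF'c : ∀ i, Continuous (F' i) := fun i =>
    (continuous_const.mul hinvc).sub ((continuous_const.mul ((hNc i).pow 2)).mul (hinvc.pow 2))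
  have hinv_le : ∀ g, (q g + ε)⁻¹ ≤ ε⁻¹ := fun g => inv_anti₀ hε (by linarith [hq0 g])
  have hinv0 : ∀ g, 0 < (q g + ε)⁻¹ := fun g => inv_pos.2 (hpos g)
  have hq_inv : ∀ g, q g * (q g + ε)⁻¹ ≤ 1 := fun g => by
    rw [← div_eq_mul_inv, div_le_one (hpos g)]; linarith
  have hNsq : ∀ g, vecNorm (N *ᵥ g) ^ 2 ≤ opNorm A ^ 2 * q g := fun g => by
    rw [hq, ← mul_pow]
    exact pow_le_pow_left₀ (vecNorm_nonneg _) (vecNorm_gram_le A g) 2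
  have hNi : ∀ i g, (N *ᵥ g) i ^ 2 ≤ opNorm A ^ 2 * q g := fun i g => by
    refine le_trans ?_ (hNsq g)
    rw [← sq_abs]
    exact pow_le_pow_left₀ (abs_nonneg _) (abs_apply_le_vecNorm _ i) 2
  have hFsq : ∀ i g, F i g ^ 2 ≤ opNorm A ^ 2 * ε⁻¹ := fun i g => by
    calc F i g ^ 2 = (N *ᵥ g) i ^ 2 * ((q g + ε)⁻¹) ^ 2 := mul_pow _ _ _
      _ ≤ opNorm A ^ 2 * q g * ((q g + ε)⁻¹) ^ 2 :=
          mul_le_mul_of_nonneg_right (hNi i g) (sq_nonneg _)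
      _ = opNorm A ^ 2 * (q g * (q g + ε)⁻¹ * (q g + ε)⁻¹) := by ring
      _ ≤ opNorm A ^ 2 * (1 * ε⁻¹) := by
          refine mul_le_mul_of_nonneg_left ?_ (sq_nonneg _)
          exact mul_le_mul (hq_inv g) (hinv_le g) (hinv0 g).le zero_le_one
      _ = _ := by ring
  have hFb : ∀ i g, ‖F i g‖ ≤ √(opNorm A ^ 2 * ε⁻¹) := fun i g =>
    Real.abs_le_sqrt (hFsq i g)
  have hFi : ∀ i, Integrable (F i) (stdGauss ι) := fun i =>
    Integrable.of_bound (hFc i).aestronglyMeasurable _ (ae_of_all _ (hFb i))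
  have hgFi : ∀ i, Integrable (fun g => g i * F i g) (stdGauss ι) := fun i =>
    (integrable_eval_stdGauss i).mul_bdd (hFc i).aestronglyMeasurable (ae_of_all _ (hFb i))
  have hinvi : Integrable (fun g => (q g + ε)⁻¹) (stdGauss ι) :=
    Integrable.of_bound hinvc.aestronglyMeasurable ε⁻¹ (ae_of_all _ fun g => by
      rw [Real.norm_eq_abs, abs_of_pos (hinv0 g)]; exact hinv_le g)
  have hF'i : ∀ i, Integrable (F' i) (stdGauss ι) := fun i => by
    refine (hinvi.const_mul _).sub ?_
    refine Integrable.of_bound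
      (((continuous_const.mul ((hNc i).pow 2)).mul (hinvc.pow 2)).aestronglyMeasurable)
      (2 * (opNorm A ^ 2 * ε⁻¹)) (ae_of_all _ fun g => ?_)
    have := hFsq i g
    rw [Real.norm_eq_abs, abs_of_nonneg (by positivity), mul_assoc, ← mul_pow]
    exact mul_le_mul_of_nonneg_left this zero_le_two
  have hderiv : ∀ i g x, HasDerivAt (fun y => F i (Function.update g i y))
      (F' i (Function.update g i x)) x := fun i g x => by
    have h1 := hasDerivAt_mulVec_update N g i i x
    have h2 := ((hasDerivAt_vecNorm_mulVec_sq_update A g i x).add_const ε).fun_inv (hpos _).ne'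
    refine (h1.fun_mul h2).congr_deriv ?_
    simp only [hF', hq, hN]
    field_simp
    ring
  have hstein : ∀ i, ∫ g, F' i g ∂stdGauss ι = ∫ g, g i * F i g ∂stdGauss ι := fun i =>
    integral_partial_stdGauss i (hderiv i) (hFi i) (hF'i i) (hgFi i)
  have hsum : ∫ g, ∑ i, F' i g ∂stdGauss ι = ∫ g, ∑ i, g i * F i g ∂stdGauss ι := by
    rw [integral_finsetSum _ fun i _ => hF'i i, integral_finsetSum _ fun i _ => hgFi i]
    exact Finset.sum_congr rfl fun i _ => hstein i
  rw [← integral_const_mul]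
  calc ∫ g, (matNorm A ^ 2 - 2 * opNorm A ^ 2) * (vecNorm (A *ᵥ g) ^ 2 + ε)⁻¹ ∂stdGauss ι
      ≤ ∫ g, ∑ i, F' i g ∂stdGauss ι := by
        refine integral_mono (hinvi.const_mul _) (integrable_finsetSum _ fun i _ => hF'i i)
          fun g => ?_
        simp only [hF']
        rw [Finset.sum_sub_distrib, ← Finset.sum_mul, ← Finset.sum_mul, ← Finset.mul_sum,
          hN, sum_diag_transpose_mul, ← hN, ← vecNorm_sq, sub_mul]
        refine sub_le_sub_left ?_ _
        calc 2 * vecNorm (N *ᵥ g) ^ 2 * ((q g + ε)⁻¹) ^ 2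
            ≤ 2 * (opNorm A ^ 2 * q g) * ((q g + ε)⁻¹) ^ 2 :=
              mul_le_mul_of_nonneg_right (mul_le_mul_of_nonneg_left (hNsq g) zero_le_two)
                (sq_nonneg _)
          _ = 2 * opNorm A ^ 2 * (q g + ε)⁻¹ * (q g * (q g + ε)⁻¹) := by ring
          _ ≤ 2 * opNorm A ^ 2 * (q g + ε)⁻¹ * 1 :=
              mul_le_mul_of_nonneg_left (hq_inv g)
                (mul_nonneg (by positivity) (hinv0 g).le)
          _ = _ := mul_one _
    _ = ∫ g, ∑ i, g i * F i g ∂stdGauss ι := hsum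
    _ ≤ ∫ _g, (1 : ℝ) ∂stdGauss ι := by
        refine integral_mono (integrable_finsetSum _ fun i _ => hgFi i) (integrable_const _)
          fun g => ?_
        simp only [hF, ← mul_assoc]
        rw [← Finset.sum_mul, hN, sum_eval_mul_mulVec]
        exact hq_inv g
    _ = 1 := by simp

/-- Inverse second moment of a Gaussian vector `A g`. -/
lemma lintegral_inv_vecNorm_sq_le (A : Matrix κ ι ℝ)
    (hA : 2 * opNorm A ^ 2 < matNorm A ^ 2) :
    ∫⁻ g, (ENNReal.ofReal (vecNorm (A *ᵥ g) ^ 2))⁻¹ ∂stdGauss ι ≤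
      ENNReal.ofReal (matNorm A ^ 2 - 2 * opNorm A ^ 2)⁻¹ := by
  have hD : 0 < matNorm A ^ 2 - 2 * opNorm A ^ 2 := by linarith
  -- The regularization is removed by Fatou's lemma along `ε = 1 / (n + 1)`.
  set u : ℕ → ℝ := fun n => 1 / ((n : ℝ) + 1) with hu
  have hu0 : ∀ n, 0 < u n := fun n => Nat.one_div_pos_of_nat
  have hulim : Tendsto u atTop (𝓝 0) := tendsto_one_div_add_atTop_nhds_zero_nat
  have hcont : ∀ n, Continuous fun g : ι → ℝ => (vecNorm (A *ᵥ g) ^ 2 + u n)⁻¹ := fun n =>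
    (((continuous_vecNorm_mulVec A).pow 2).add continuous_const).inv₀ fun g =>
      (add_pos_of_nonneg_of_pos (sq_nonneg _) (hu0 n)).ne'
  have hlim : ∀ g : ι → ℝ, Tendsto (fun n => ENNReal.ofReal (vecNorm (A *ᵥ g) ^ 2 + u n)⁻¹) atTop
      (𝓝 (ENNReal.ofReal (vecNorm (A *ᵥ g) ^ 2))⁻¹) := fun g => by
    have h1 : ∀ n, ENNReal.ofReal (vecNorm (A *ᵥ g) ^ 2 + u n)⁻¹ =
        (ENNReal.ofReal (vecNorm (A *ᵥ g) ^ 2 + u n))⁻¹ := fun n =>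
      ENNReal.ofReal_inv_of_pos (add_pos_of_nonneg_of_pos (sq_nonneg _) (hu0 n))
    simp_rw [h1]
    refine Tendsto.inv (ENNReal.tendsto_ofReal ?_)
    simpa using hulim.const_add (vecNorm (A *ᵥ g) ^ 2)
  calc _ = ∫⁻ g, liminf (fun n => ENNReal.ofReal (vecNorm (A *ᵥ g) ^ 2 + u n)⁻¹) atTop
        ∂stdGauss ι := lintegral_congr fun g => (hlim g).liminf_eq.symm
    _ ≤ liminf (fun n => ∫⁻ g, ENNReal.ofReal (vecNorm (A *ᵥ g) ^ 2 + u n)⁻¹ ∂stdGauss ι) atTop :=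
        lintegral_liminf_le fun n => (hcont n).measurable.ennreal_ofReal
    _ ≤ _ := by
        refine liminf_le_of_le (by isBoundedDefault) fun b hb => ?_
        obtain ⟨n, hn⟩ := hb.exists
        refine hn.trans ?_
        rw [← ofReal_integral_eq_lintegral_ofReal]
        · refine ENNReal.ofReal_le_ofReal ?_
          rw [inv_eq_one_div, le_div_iff₀ hD, mul_comm]
          exact integral_inv_vecNorm_sq_add_le A (hu0 n)
        · refine Integrable.of_bound (hcont n).aestronglyMeasurable (u n)⁻¹
            (ae_of_all _ fun g => ?_)
          rw [Real.norm_eq_abs, abs_of_pos (inv_pos.2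
            (add_pos_of_nonneg_of_pos (sq_nonneg _) (hu0 n)))]
          exact inv_anti₀ (hu0 n) (le_add_of_nonneg_left (sq_nonneg _))
        · exact ae_of_all _ fun g => inv_nonneg.2
            (add_pos_of_nonneg_of_pos (sq_nonneg _) (hu0 n)).le

/-- The Euclidean norm of a Gaussian vector `A g` concentrates around the Frobenius norm of `A`. -/
lemma lintegral_vecNorm_sub_matNorm_sq_le (A : Matrix κ ι ℝ) :
    ∫⁻ g, ENNReal.ofReal ((vecNorm (A *ᵥ g) - matNorm A) ^ 2) ∂stdGauss ι ≤
      ENNReal.ofReal (8 * opNorm A ^ 2) := by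
  have hi := integrable_vecNorm_mulVec_sq A
  have hm : Measurable fun g : ι → ℝ => vecNorm (A *ᵥ g) :=
    (continuous_vecNorm_mulVec A).measurable
  have hq : ∫⁻ g, ENNReal.ofReal (vecNorm (A *ᵥ g) ^ 2) ∂stdGauss ι =
      ENNReal.ofReal (matNorm A ^ 2) := by
    rw [← ofReal_integral_eq_lintegral_ofReal hi (ae_of_all _ fun g => sq_nonneg _),
      integral_vecNorm_mulVec_sq]
  -- If `‖A‖_F² < 4 ‖A‖²`, the crude bound `2 ‖A‖_F²` suffices, and this is where the `8` comes
  -- from. Otherwise the inverse moment is available.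
  rcases lt_or_ge (matNorm A ^ 2) (4 * opNorm A ^ 2) with h | h
  · calc _ ≤ ∫⁻ g, (ENNReal.ofReal (vecNorm (A *ᵥ g) ^ 2) + ENNReal.ofReal (matNorm A ^ 2))
          ∂stdGauss ι := by
          refine lintegral_mono fun g => ?_
          rw [← ENNReal.ofReal_add (sq_nonneg _) (sq_nonneg _)]
          refine ENNReal.ofReal_le_ofReal ?_
          nlinarith [mul_nonneg (vecNorm_nonneg (A *ᵥ g)) (matNorm_nonneg A)]
      _ = ENNReal.ofReal (2 * matNorm A ^ 2) := by
          rw [lintegral_add_right _ measurable_const, hq, lintegral_const, measure_univ, mul_one,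
            ← ENNReal.ofReal_add (sq_nonneg _) (sq_nonneg _), two_mul]
      _ ≤ _ := ENNReal.ofReal_le_ofReal (by linarith)
  · rcases (opNorm_nonneg A).eq_or_lt with h0 | h0
    · have hz : ∀ g, vecNorm (A *ᵥ g) = 0 := fun g =>
        le_antisymm (by simpa [← h0] using vecNorm_mulVec_le A g) (vecNorm_nonneg _)
      have hF : matNorm A = 0 := by
        have := matNorm_sq_le_card_mul A
        rw [← h0] at this
        nlinarith [matNorm_nonneg A]
      simp [hz, hF]
    have hD : 2 * opNorm A ^ 2 < matNorm A ^ 2 := by nlinarith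
    set F := matNorm A
    set M := opNorm A
    have hlint := lintegral_inv_vecNorm_sq_le A hD
    -- With `v = |A g|`, `v² + F⁴ / v² - 2 F² = (v - F)² (v + F)² / v² ≥ (v - F)²`. Thus a second
    -- moment and an inverse second moment, both close to their ideal values, force concentration.
    -- At `v = 0` the right side is infinite.
    have hpt : ∀ g : ι → ℝ, ENNReal.ofReal ((vecNorm (A *ᵥ g) - F) ^ 2) +
        ENNReal.ofReal (2 * F ^ 2) ≤ ENNReal.ofReal (vecNorm (A *ᵥ g) ^ 2) +
          ENNReal.ofReal (F ^ 4) * (ENNReal.ofReal (vecNorm (A *ᵥ g) ^ 2))⁻¹ := fun g => by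
      rcases (vecNorm_nonneg (A *ᵥ g)).eq_or_lt with hv | hv
      · have : ENNReal.ofReal (F ^ 4) ≠ 0 := by
          have : 0 < F ^ 2 := by nlinarith
          simp only [ne_eq, ENNReal.ofReal_eq_zero, not_le]
          nlinarith
        simp [← hv, this]
      · rw [← ENNReal.ofReal_inv_of_pos (by positivity), ← ENNReal.ofReal_mul (by positivity),
          ← ENNReal.ofReal_add (by positivity) (by positivity),
          ← ENNReal.ofReal_add (by positivity) (by positivity)]
        refine ENNReal.ofReal_le_ofReal ?_
        set v := vecNorm (A *ᵥ g)
        have hF0 : 0 ≤ F := matNorm_nonneg A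
        have : v ^ 2 + F ^ 4 * (v ^ 2)⁻¹ - 2 * F ^ 2 - (v - F) ^ 2 =
            (v - F) ^ 2 * (2 * v * F + F ^ 2) * (v ^ 2)⁻¹ := by
          field_simp; ring
        have h2 : 0 ≤ (v - F) ^ 2 * (2 * v * F + F ^ 2) * (v ^ 2)⁻¹ := by positivity
        linarith
    have hint : ∫⁻ g, ENNReal.ofReal ((vecNorm (A *ᵥ g) - F) ^ 2) ∂stdGauss ι +
        ENNReal.ofReal (2 * F ^ 2) ≤
        ENNReal.ofReal (8 * M ^ 2) + ENNReal.ofReal (2 * F ^ 2) := by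
      calc _ = ∫⁻ g, (ENNReal.ofReal ((vecNorm (A *ᵥ g) - F) ^ 2) +
            ENNReal.ofReal (2 * F ^ 2)) ∂stdGauss ι := by
            rw [lintegral_add_right _ measurable_const, lintegral_const, measure_univ, mul_one]
        _ ≤ ∫⁻ g, (ENNReal.ofReal (vecNorm (A *ᵥ g) ^ 2) +
            ENNReal.ofReal (F ^ 4) * (ENNReal.ofReal (vecNorm (A *ᵥ g) ^ 2))⁻¹) ∂stdGauss ι :=
            lintegral_mono hpt
        _ ≤ ENNReal.ofReal (F ^ 2) +
            ENNReal.ofReal (F ^ 4) * ENNReal.ofReal (F ^ 2 - 2 * M ^ 2)⁻¹ := by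
            rw [lintegral_add_left (by fun_prop), hq, lintegral_const_mul _ (by fun_prop)]
            gcongr
        _ = ENNReal.ofReal (F ^ 2 + F ^ 4 * (F ^ 2 - 2 * M ^ 2)⁻¹) := by
            rw [← ENNReal.ofReal_mul (by positivity), ← ENNReal.ofReal_add (by positivity)]
            exact mul_nonneg (by positivity) (inv_nonneg.2 (by linarith))
        _ ≤ ENNReal.ofReal (8 * M ^ 2 + 2 * F ^ 2) := by
            refine ENNReal.ofReal_le_ofReal ?_
            have hpos : 0 < F ^ 2 - 2 * M ^ 2 := by linarith
            -- After clearing the denominator this is exactly `F² ≥ 4 M²`, the present case.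
            have : F ^ 4 * (F ^ 2 - 2 * M ^ 2)⁻¹ ≤ F ^ 2 + 4 * M ^ 2 := by
              rw [← div_eq_mul_inv, div_le_iff₀ hpos]
              nlinarith [mul_nonneg (sq_nonneg M) (sub_nonneg.2 h)]
            nlinarith [sq_nonneg M]
        _ = _ := ENNReal.ofReal_add (by positivity) (by positivity)
    exact (ENNReal.add_le_add_iff_right ENNReal.ofReal_ne_top).1 hint

end InverseMoment

/-! ### Lipschitz continuity of the cosine loss. -/

section CosineLoss

/-- Cauchy–Schwarz: the second moment of `B g` against the inverse second moment of `A g`. -/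
lemma lintegral_vecNorm_ratio_le {ι κ : Type*} [Fintype ι] [Fintype κ] (A B : Matrix κ ι ℝ)
    (hA : 2 * opNorm A ^ 2 < matNorm A ^ 2) :
    ∫⁻ g, ENNReal.ofReal (vecNorm (B *ᵥ g)) * (ENNReal.ofReal (vecNorm (A *ᵥ g)))⁻¹ ∂stdGauss ι ≤
      ENNReal.ofReal (matNorm B * √(matNorm A ^ 2 - 2 * opNorm A ^ 2)⁻¹) := by
  have hmA := (continuous_vecNorm_mulVec A).measurable
  have hmB := (continuous_vecNorm_mulVec B).measurable
  refine (ENNReal.lintegral_mul_le_Lp_mul_Lq _ Real.HolderConjugate.two_two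
    hmB.ennreal_ofReal.aemeasurable hmA.ennreal_ofReal.inv.aemeasurable).trans ?_
  have h1 : ∫⁻ g, ENNReal.ofReal (vecNorm (B *ᵥ g)) ^ (2 : ℝ) ∂stdGauss ι =
      ENNReal.ofReal (matNorm B ^ 2) := by
    rw [← integral_vecNorm_mulVec_sq, ofReal_integral_eq_lintegral_ofReal
      (integrable_vecNorm_mulVec_sq B) (ae_of_all _ fun g => sq_nonneg _)]
    refine lintegral_congr fun g => ?_
    rw [ENNReal.rpow_two, ENNReal.ofReal_pow (vecNorm_nonneg _)]
  have h2 : ∫⁻ g, (ENNReal.ofReal (vecNorm (A *ᵥ g)))⁻¹ ^ (2 : ℝ) ∂stdGauss ι ≤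
      ENNReal.ofReal (matNorm A ^ 2 - 2 * opNorm A ^ 2)⁻¹ := by
    refine le_trans (le_of_eq ?_) (lintegral_inv_vecNorm_sq_le A hA)
    refine lintegral_congr fun g => ?_
    rw [ENNReal.rpow_two, ENNReal.ofReal_pow (vecNorm_nonneg _), ENNReal.inv_pow]
  rw [h1, ENNReal.ofReal_mul (matNorm_nonneg B)]
  refine mul_le_mul' (le_of_eq ?_) ((ENNReal.rpow_le_rpow h2 (by norm_num)).trans (le_of_eq ?_))
  · rw [ENNReal.ofReal_rpow_of_nonneg (sq_nonneg _) (by norm_num), ← Real.sqrt_eq_rpow,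
      Real.sqrt_sq (matNorm_nonneg B)]
  · rw [ENNReal.ofReal_rpow_of_nonneg (inv_nonneg.2 (by linarith)) (by norm_num),
      ← Real.sqrt_eq_rpow]

/-- Cosine similarity, with value `0` when one of the vectors vanishes. -/
noncomputable def cosSim {ι : Type*} [Fintype ι] (u v : ι → ℝ) : ℝ :=
  (u ⬝ᵥ v) / (vecNorm u * vecNorm v)

section

variable {ι κ : Type*} [Fintype ι]

lemma abs_cosSim_le_one (u v : ι → ℝ) : |cosSim u v| ≤ 1 := by
  rw [cosSim, abs_div, abs_of_nonneg (mul_nonneg (vecNorm_nonneg u) (vecNorm_nonneg v))]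
  exact div_le_one_of_le₀ (abs_dotProduct_le u v)
    (mul_nonneg (vecNorm_nonneg u) (vecNorm_nonneg v))

/-- The change splits into the change of the numerator and the change of the norm, each at most `|u
- w| / |u|`. Only `u` has to stay away from zero, so the perturbed matrix later needs no margin;
when `w = 0` its similarity is `0` by the division convention and the bound equals `2`. -/
lemma abs_cosSim_sub_le {u : ι → ℝ} (hu : u ≠ 0) (w v : ι → ℝ) :
    |cosSim u v - cosSim w v| ≤ 2 * (vecNorm (u - w) * (vecNorm u)⁻¹) := by
  have hu' : 0 < vecNorm u := (vecNorm_nonneg u).lt_of_ne' fun h => hu (vecNorm_eq_zero.1 h)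
  by_cases hw : w = 0
  · subst hw
    have : cosSim (0 : ι → ℝ) v = 0 := by simp [cosSim]
    rw [this, sub_zero, sub_zero, mul_inv_cancel₀ hu'.ne']
    linarith [abs_cosSim_le_one u v]
  by_cases hv : v = 0
  · subst hv
    simp only [cosSim, dotProduct_zero, zero_div, sub_zero, abs_zero]
    exact mul_nonneg zero_le_two (mul_nonneg (vecNorm_nonneg _) (inv_nonneg.2 hu'.le))
  have hw' : 0 < vecNorm w := (vecNorm_nonneg w).lt_of_ne' fun h => hw (vecNorm_eq_zero.1 h)
  have hv' : 0 < vecNorm v := (vecNorm_nonneg v).lt_of_ne' fun h => hv (vecNorm_eq_zero.1 h)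
  have e : cosSim u v - cosSim w v =
      ((u - w) ⬝ᵥ v) * (vecNorm u)⁻¹ * (vecNorm v)⁻¹ +
        cosSim w v * ((vecNorm w - vecNorm u) * (vecNorm u)⁻¹) := by
    rw [sub_dotProduct, cosSim, cosSim]
    field_simp
    ring
  rw [e, two_mul]
  refine (abs_add_le _ _).trans (add_le_add ?_ ?_)
  · rw [abs_mul, abs_mul, abs_of_pos (inv_pos.2 hu'), abs_of_pos (inv_pos.2 hv'),
      ← div_eq_mul_inv _ (vecNorm v), div_le_iff₀ hv']
    calc |(u - w) ⬝ᵥ v| * (vecNorm u)⁻¹ ≤ vecNorm (u - w) * vecNorm v * (vecNorm u)⁻¹ :=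
          mul_le_mul_of_nonneg_right (abs_dotProduct_le _ _) (inv_nonneg.2 hu'.le)
      _ = _ := by ring
  · rw [abs_mul, abs_mul, abs_of_pos (inv_pos.2 hu')]
    calc _ ≤ 1 * (vecNorm (u - w) * (vecNorm u)⁻¹) := by
          refine mul_le_mul (abs_cosSim_le_one w v) ?_ (by positivity) zero_le_one
          refine mul_le_mul_of_nonneg_right ?_ (inv_nonneg.2 hu'.le)
          rw [vecNorm_sub_comm]
          exact abs_vecNorm_sub_le w u
      _ = _ := one_mul _

/-- In `ENNReal` the bound persists for `u = 0`: it is infinite if `w ≠ 0`, and both sides vanish if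
`w = 0`. No exceptional set has to be discarded. -/
lemma ofReal_abs_cosSim_sub_le (u w v : ι → ℝ) :
    ENNReal.ofReal |cosSim u v - cosSim w v| ≤
      2 * (ENNReal.ofReal (vecNorm (u - w)) * (ENNReal.ofReal (vecNorm u))⁻¹) := by
  by_cases hu : u = 0
  · subst hu
    by_cases hw : w = 0
    · subst hw; simp
    · have hw' : 0 < vecNorm w := (vecNorm_nonneg w).lt_of_ne' fun h => hw (vecNorm_eq_zero.1 h)
      have : ENNReal.ofReal (vecNorm w) ≠ 0 := by simpa using hw'
      simp [vecNorm_neg, vecNorm_zero, ENNReal.mul_top, this]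
  · have hu' : 0 < vecNorm u := (vecNorm_nonneg u).lt_of_ne' fun h => hu (vecNorm_eq_zero.1 h)
    refine (ENNReal.ofReal_le_ofReal (abs_cosSim_sub_le hu w v)).trans (le_of_eq ?_)
    rw [ENNReal.ofReal_mul zero_le_two, ENNReal.ofReal_mul (vecNorm_nonneg _),
      ENNReal.ofReal_inv_of_pos hu', ENNReal.ofReal_ofNat]

lemma measurable_cosSim : Measurable fun p : (ι → ℝ) × (ι → ℝ) => cosSim p.1 p.2 := by
  refine Measurable.div ?_ ?_
  · exact (Continuous.dotProduct continuous_fst continuous_snd).measurable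
  · exact ((continuous_vecNorm.comp continuous_fst).mul
      (continuous_vecNorm.comp continuous_snd)).measurable

/-- A view `x₀ + σ z` is turned into one standard Gaussian vector on the doubled index set. -/
lemma fromCols_smul_mulVec (A : Matrix κ ι ℝ) (c : ℝ) (g : ι ⊕ ι → ℝ) :
    fromCols A (c • A) *ᵥ g = A *ᵥ (g ∘ Sum.inl + c • (g ∘ Sum.inr)) := by
  rw [fromCols_mulVec, mulVec_add, mulVec_smul, smul_mulVec]

variable [Fintype κ]

lemma opNorm_fromCols_smul_sq_le (A : Matrix κ ι ℝ) (c : ℝ) :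
    opNorm (fromCols A (c • A)) ^ 2 ≤ (1 + c ^ 2) * opNorm A ^ 2 := by
  have h : opNorm (fromCols A (c • A)) ≤ √(1 + c ^ 2) * opNorm A := by
    refine opNorm_le (mul_nonneg (Real.sqrt_nonneg _) (opNorm_nonneg _)) fun g => ?_
    rw [fromCols_smul_mulVec]
    refine (vecNorm_mulVec_le _ _).trans ?_
    rw [mul_comm √(1 + c ^ 2), mul_assoc]
    refine mul_le_mul_of_nonneg_left ?_ (opNorm_nonneg _)
    refine abs_le_of_sq_le_sq' ?_ (mul_nonneg (Real.sqrt_nonneg _) (vecNorm_nonneg _)) |>.2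
    rw [mul_pow, Real.sq_sqrt (by positivity), vecNorm_sq, vecNorm_sq, Fintype.sum_sum_type,
      ← Finset.sum_add_distrib, Finset.mul_sum]
    refine Finset.sum_le_sum fun i _ => ?_
    simp only [Pi.add_apply, Function.comp_apply, Pi.smul_apply, smul_eq_mul]
    nlinarith [sq_nonneg (c * g (Sum.inl i) - g (Sum.inr i))]
  calc _ ≤ (√(1 + c ^ 2) * opNorm A) ^ 2 := pow_le_pow_left₀ (opNorm_nonneg _) h 2
    _ = _ := by rw [mul_pow, Real.sq_sqrt (by positivity)]

lemma matNorm_fromCols_smul_sq (A : Matrix κ ι ℝ) (c : ℝ) :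
    matNorm (fromCols A (c • A)) ^ 2 = (1 + c ^ 2) * matNorm A ^ 2 := by
  simp only [matNorm_sq, Fintype.sum_sum_type, fromCols_apply_inl, fromCols_apply_inr,
    Matrix.smul_apply, smul_eq_mul, mul_pow]
  rw [Finset.mul_sum]
  refine Finset.sum_congr rfl fun i _ => ?_
  rw [← Finset.mul_sum]
  ring

/-- Adjoining the noise multiplies squared Frobenius norms by exactly `1 + c²` and squared operator
norms by at most `1 + c²`. The factor cancels in the ratio, so the bound does not depend on the
noise level. -/
lemma lintegral_prod_vecNorm_ratio_le (A B : Matrix κ ι ℝ) (c : ℝ)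
    (hA : 2 * opNorm A ^ 2 < matNorm A ^ 2) :
    ∫⁻ p, ENNReal.ofReal (vecNorm (B *ᵥ (p.1 + c • p.2))) *
        (ENNReal.ofReal (vecNorm (A *ᵥ (p.1 + c • p.2))))⁻¹ ∂(stdGauss ι).prod (stdGauss ι) ≤
      ENNReal.ofReal (matNorm B * √(matNorm A ^ 2 - 2 * opNorm A ^ 2)⁻¹) := by
  have hmp := measurePreserving_sumPiEquivProdPi (X := fun _ : ι ⊕ ι => ℝ)
    (fun _ => gaussianReal 0 1)
  have hc : 0 < 1 + c ^ 2 := by positivity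
  have hD : 0 < matNorm A ^ 2 - 2 * opNorm A ^ 2 := by linarith
  have ho := opNorm_fromCols_smul_sq_le A c
  have hF := matNorm_fromCols_smul_sq A c
  have hlow : (1 + c ^ 2) * (matNorm A ^ 2 - 2 * opNorm A ^ 2) ≤
      matNorm (fromCols A (c • A)) ^ 2 - 2 * opNorm (fromCols A (c • A)) ^ 2 := by
    rw [hF]; linarith
  have hpos := mul_pos hc hD
  have key := lintegral_vecNorm_ratio_le (fromCols A (c • A)) (fromCols B (c • B)) (by linarith)
  simp_rw [fromCols_smul_mulVec] at key
  have e := hmp.lintegral_comp_emb (MeasurableEquiv.measurableEmbedding _)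
    fun p : (ι → ℝ) × (ι → ℝ) => ENNReal.ofReal (vecNorm (B *ᵥ (p.1 + c • p.2))) *
        (ENNReal.ofReal (vecNorm (A *ᵥ (p.1 + c • p.2))))⁻¹
  refine (le_of_eq e.symm).trans (key.trans (ENNReal.ofReal_le_ofReal ?_))
  have hB : matNorm (fromCols B (c • B)) = √(1 + c ^ 2) * matNorm B := by
    rw [← Real.sqrt_sq (matNorm_nonneg (fromCols B _)), matNorm_fromCols_smul_sq,
      Real.sqrt_mul hc.le, Real.sqrt_sq (matNorm_nonneg B)]
  calc _ ≤ √(1 + c ^ 2) * matNorm B *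
        √((1 + c ^ 2) * (matNorm A ^ 2 - 2 * opNorm A ^ 2))⁻¹ := by
        rw [hB]
        refine mul_le_mul_of_nonneg_left (Real.sqrt_le_sqrt (inv_anti₀ hpos hlow))
          (mul_nonneg (Real.sqrt_nonneg _) (matNorm_nonneg _))
    _ = _ := by
        have : √(1 + c ^ 2) ≠ 0 := (Real.sqrt_pos.2 hc).ne'
        rw [mul_inv, Real.sqrt_mul (inv_nonneg.2 hc.le), Real.sqrt_inv (1 + c ^ 2)]
        field_simp

end

lemma isoGaussian_eq_map {d : ℕ} (x : Fin d → ℝ) (σ : ℝ) :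
    isoGaussian x σ = (stdGauss (Fin d)).map fun z => x + σ • z := by
  have h : ∀ i, gaussianReal (x i) (Real.toNNReal (σ ^ 2)) =
      (gaussianReal 0 1).map fun z => x i + σ * z := fun i => by
    have := gaussianReal_map_const_add (μ := σ * 0) (v := NNReal.mk (σ ^ 2) (sq_nonneg σ) * 1) (x i)
    rw [← gaussianReal_map_const_mul, Measure.map_map (by fun_prop) (by fun_prop)] at this
    rw [Function.comp_def] at this
    rw [this, mul_zero, zero_add, mul_one]
    congr 1
    ext
    simp [sq_nonneg]
  rw [isoGaussian]
  simp_rw [h]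
  rw [← Measure.pi_map_pi (fun i => by fun_prop)]
  rfl

lemma isoGaussian_zero_one {d : ℕ} : isoGaussian (0 : Fin d → ℝ) 1 = stdGauss (Fin d) := by
  simp [isoGaussian]

variable {d h : ℕ}

lemma measurable_cosSim_mulVec {ι κ : Type*} [Fintype ι] [Fintype κ] (A B : Matrix κ ι ℝ) (σ : ℝ) :
    Measurable fun p : (ι → ℝ) × (ι → ℝ) × (ι → ℝ) =>
      cosSim (A *ᵥ (p.1 + σ • p.2.1)) (B *ᵥ (p.1 + σ • p.2.2)) :=
  measurable_cosSim.comp (Measurable.prodMk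
    ((continuous_mulVec A).measurable.comp (by fun_prop))
    ((continuous_mulVec B).measurable.comp (by fun_prop)))

lemma integrable_cosSim_mulVec {ι κ : Type*} [Fintype ι] [Fintype κ] (A B : Matrix κ ι ℝ) (σ : ℝ) :
    Integrable (fun p : (ι → ℝ) × (ι → ℝ) × (ι → ℝ) =>
      cosSim (A *ᵥ (p.1 + σ • p.2.1)) (B *ᵥ (p.1 + σ • p.2.2)))
      ((stdGauss ι).prod ((stdGauss ι).prod (stdGauss ι))) :=
  Integrable.of_bound (measurable_cosSim_mulVec A B σ).aestronglyMeasurable 1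
    (ae_of_all _ fun _ => abs_cosSim_le_one _ _)

/-- The views are written as `x₀ + σ z`, which removes the dependence of the inner measures on `x₀`;
boundedness of the integrand allows Fubini. -/
lemma cosLoss_eq_integral_prod (σ : ℝ) (Φ : Matrix (Fin h) (Fin d) ℝ)
    (W : Matrix (Fin h) (Fin h) ℝ) (Φbar : Matrix (Fin h) (Fin d) ℝ) :
    cosLoss σ Φ W Φbar = -∫ p, cosSim ((W * Φ) *ᵥ (p.1 + σ • p.2.1)) (Φbar *ᵥ (p.1 + σ • p.2.2))
      ∂(stdGauss (Fin d)).prod ((stdGauss (Fin d)).prod (stdGauss (Fin d))) := by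
  have hi := integrable_cosSim_mulVec (W * Φ) Φbar σ
  rw [integral_prod _ hi, ← integral_neg, cosLoss, isoGaussian_zero_one]
  refine integral_congr_ae ?_
  filter_upwards [hi.prod_right_ae] with x₀ hx₀
  rw [integral_prod _ hx₀, ← integral_neg, isoGaussian_eq_map, integral_map (by fun_prop)]
  · refine integral_congr_ae (ae_of_all _ fun z => ?_)
    dsimp only
    rw [integral_map (by fun_prop), ← integral_neg]
    · rfl
    · exact ((measurable_cosSim.comp (measurable_const.prodMk
        (continuous_mulVec Φbar).measurable)).neg).aestronglyMeasurable
  · refine StronglyMeasurable.aestronglyMeasurable ?_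
    refine StronglyMeasurable.integral_prod_right' (f := fun p : (Fin d → ℝ) × (Fin d → ℝ) =>
      -cosSim ((W * Φ) *ᵥ p.1) (Φbar *ᵥ p.2)) ?_
    exact ((measurable_cosSim.comp (Measurable.prodMk
      ((continuous_mulVec _).measurable.comp measurable_fst)
      ((continuous_mulVec _).measurable.comp measurable_snd))).neg).stronglyMeasurable

lemma lintegral_prod_prod_const_mul {X : Type*} [MeasurableSpace X] (γ : Measure X)
    [IsProbabilityMeasure γ] {R : X × X → ENNReal} (hR : Measurable R) (c : ENNReal) :
    ∫⁻ p, c * R (p.1, p.2.1) ∂γ.prod (γ.prod γ) = c * ∫⁻ p, R p ∂γ.prod γ := by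
  have hmp : MeasurePreserving (fun p : X × X × X => (p.1, p.2.1))
      (γ.prod (γ.prod γ)) (γ.prod γ) :=
    (MeasurePreserving.id γ).prod measurePreserving_fst
  rw [← hmp.lintegral_comp hR]
  exact lintegral_const_mul c (hR.comp hmp.measurable)

/-- Lipschitz bound for the cosine loss in terms of the product `W Φ`. -/
lemma abs_cosLoss_sub_le (σ : ℝ) {Φ Φ' : Matrix (Fin h) (Fin d) ℝ}
    {W W' : Matrix (Fin h) (Fin h) ℝ} (Φbar : Matrix (Fin h) (Fin d) ℝ)
    (hA : 2 * opNorm (W * Φ) ^ 2 < matNorm (W * Φ) ^ 2) :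
    |cosLoss σ Φ' W' Φbar - cosLoss σ Φ W Φbar| ≤
      2 * √(matNorm (W * Φ) ^ 2 - 2 * opNorm (W * Φ) ^ 2)⁻¹ * matNorm (W' * Φ' - W * Φ) := by
  set γ := stdGauss (Fin d)
  have hi := integrable_cosSim_mulVec (W * Φ) Φbar σ
  have hi' := integrable_cosSim_mulVec (W' * Φ') Φbar σ
  rw [cosLoss_eq_integral_prod, cosLoss_eq_integral_prod, neg_sub_neg, ← integral_sub hi hi']
  have hmeas : Measurable fun p : (Fin d → ℝ) × (Fin d → ℝ) =>
      ENNReal.ofReal (vecNorm ((W * Φ - W' * Φ') *ᵥ (p.1 + σ • p.2))) *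
        (ENNReal.ofReal (vecNorm ((W * Φ) *ᵥ (p.1 + σ • p.2))))⁻¹ :=
    (((continuous_vecNorm_mulVec _).measurable.comp (by fun_prop)).ennreal_ofReal).mul
      (((continuous_vecNorm_mulVec _).measurable.comp (by fun_prop)).ennreal_ofReal.inv)
  refine (ENNReal.ofReal_le_ofReal_iff (mul_nonneg (by positivity) (matNorm_nonneg _))).1 ?_
  calc _ ≤ ∫⁻ p, ENNReal.ofReal |cosSim ((W * Φ) *ᵥ (p.1 + σ • p.2.1))
          (Φbar *ᵥ (p.1 + σ • p.2.2)) - cosSim ((W' * Φ') *ᵥ (p.1 + σ • p.2.1))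
          (Φbar *ᵥ (p.1 + σ • p.2.2))| ∂γ.prod (γ.prod γ) := by
        simpa [← ofReal_norm] using enorm_integral_le_lintegral_enorm
          (μ := γ.prod (γ.prod γ)) fun p => cosSim ((W * Φ) *ᵥ (p.1 + σ • p.2.1))
          (Φbar *ᵥ (p.1 + σ • p.2.2)) - cosSim ((W' * Φ') *ᵥ (p.1 + σ • p.2.1))
          (Φbar *ᵥ (p.1 + σ • p.2.2))
    _ ≤ ∫⁻ p, 2 * (ENNReal.ofReal (vecNorm ((W * Φ - W' * Φ') *ᵥ (p.1 + σ • p.2.1))) *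
        (ENNReal.ofReal (vecNorm ((W * Φ) *ᵥ (p.1 + σ • p.2.1))))⁻¹) ∂γ.prod (γ.prod γ) := by
        refine lintegral_mono fun p => ?_
        rw [sub_mulVec]
        exact ofReal_abs_cosSim_sub_le _ _ _
    _ = 2 * ∫⁻ p, ENNReal.ofReal (vecNorm ((W * Φ - W' * Φ') *ᵥ (p.1 + σ • p.2))) *
        (ENNReal.ofReal (vecNorm ((W * Φ) *ᵥ (p.1 + σ • p.2))))⁻¹ ∂γ.prod γ :=
        lintegral_prod_prod_const_mul _ hmeas 2
    _ ≤ 2 * ENNReal.ofReal (matNorm (W * Φ - W' * Φ') *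
        √(matNorm (W * Φ) ^ 2 - 2 * opNorm (W * Φ) ^ 2)⁻¹) := by
        gcongr
        exact lintegral_prod_vecNorm_ratio_le _ _ σ hA
    _ = _ := by
        rw [← ENNReal.ofReal_ofNat, ← ENNReal.ofReal_mul zero_le_two, matNorm_sub_comm]
        congr 1
        ring

end CosineLoss

/-! ### Gradient bounds and stability of the flow. -/

section GradientFlow

/-- The entries of a matrix, as a Euclidean vector. -/
noncomputable def matVec {κ ι : Type*} [Fintype κ] [Fintype ι] :
    Matrix κ ι ℝ →L[ℝ] EuclideanSpace ℝ (κ × ι) :=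
  LinearMap.toContinuousLinearMap
    { toFun := fun A => WithLp.toLp 2 fun p : κ × ι => A p.1 p.2
      map_add' := fun _ _ => rfl
      map_smul' := fun _ _ => rfl }

lemma norm_matVec {κ ι : Type*} [Fintype κ] [Fintype ι] (A : Matrix κ ι ℝ) :
    ‖matVec A‖ = matNorm A := rfl

attribute [local instance] Matrix.normedAddCommGroup Matrix.normedSpace

lemma frobInner_add_smul_self {m k : ℕ} (A B : Matrix (Fin m) (Fin k) ℝ) (τ : ℝ) :
    matNorm (A + τ • B) ^ 2 = matNorm A ^ 2 + 2 * frobInner A B * τ + matNorm B ^ 2 * τ ^ 2 := by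
  simp only [matNorm_sq, frobInner, Finset.mul_sum, Finset.sum_mul, ← Finset.sum_add_distrib]
  refine Finset.sum_congr rfl fun i _ => Finset.sum_congr rfl fun j _ => ?_
  simp only [Matrix.add_apply, Matrix.smul_apply, smul_eq_mul]
  ring

lemma frobInner_sub_smul_left {m k : ℕ} (A B C : Matrix (Fin m) (Fin k) ℝ) (ρ : ℝ) :
    frobInner (A - ρ • B) C = frobInner A C - ρ * frobInner B C := by
  simp only [frobInner, Finset.mul_sum, ← Finset.sum_sub_distrib]
  refine Finset.sum_congr rfl fun i _ => Finset.sum_congr rfl fun j _ => ?_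
  simp only [Matrix.sub_apply, Matrix.smul_apply, smul_eq_mul]
  ring

/-- If `f` is the sum of a `K`-Lipschitz (at `A`) function and a quadratic weight decay, then its
gradient differs from the gradient of the decay by at most `K`. -/
lemma matNorm_grad_sub_le {m k : ℕ} {f l : Matrix (Fin m) (Fin k) ℝ → ℝ}
    {S : Submodule ℝ (Matrix (Fin m) (Fin k) ℝ)} {A G : Matrix (Fin m) (Fin k) ℝ} {ρ c K : ℝ}
    (hA : A ∈ S) (hG : IsGradOn f S A G) (hK : 0 ≤ K)
    (hf : ∀ B, f B = l B + (ρ / 2 * frobNorm B ^ 2 + c))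
    (hl : ∀ B, |l B - l A| ≤ K * matNorm (B - A)) : matNorm (G - ρ • A) ≤ K := by
  obtain ⟨hGS, L, hL, hLG⟩ := hG
  -- Test direction: the derivative of `l` at `A` along `B = G - ρ A` is `⟨G - ρ A, B⟩ = ‖B‖_F²`,
  -- while the Lipschitz bound makes it at most `K ‖B‖_F`. As `B ∈ S`, the whole line stays in `S`.
  set B := G - ρ • A with hB
  have hBS : B ∈ S := S.sub_mem hGS (S.smul_mem ρ hA)
  have h1 : HasDerivAt (fun τ : ℝ => f (A + τ • B)) (frobInner G B) 0 := by
    have e : HasLineDerivWithinAt ℝ f (frobInner G B) (S : Set (Matrix (Fin m) (Fin k) ℝ)) A B := by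
      rw [← hLG B hBS]
      exact hL.hasLineDerivWithinAt B
    rw [HasLineDerivWithinAt] at e
    have hu : ((fun τ : ℝ => A + τ • B) ⁻¹' (S : Set (Matrix (Fin m) (Fin k) ℝ))) = Set.univ :=
      Set.eq_univ_of_forall fun τ => S.add_mem hA (S.smul_mem τ hBS)
    rwa [hu, hasDerivWithinAt_univ] at e
  have h2 : HasDerivAt (fun τ : ℝ => ρ / 2 * frobNorm (A + τ • B) ^ 2 + c)
      (ρ * frobInner A B) 0 := by
    simp_rw [frobNorm_eq_matNorm, frobInner_add_smul_self]
    have h3 := (((hasDerivAt_id' (0 : ℝ)).const_mul (2 * frobInner A B)).const_add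
      (matNorm A ^ 2)).fun_add (((hasDerivAt_id' (0 : ℝ)).fun_pow 2).const_mul (matNorm B ^ 2))
    refine ((h3.const_mul (ρ / 2)).add_const c).congr_deriv ?_
    ring
  have h3 : HasDerivAt (fun τ : ℝ => l (A + τ • B)) (matNorm B ^ 2) 0 := by
    have h4 := h1.fun_sub h2
    rw [← frobInner_sub_smul_left, ← hB, frobInner_self] at h4
    refine h4.congr_of_eventuallyEq (Eventually.of_forall fun τ => ?_)
    simp only [hf, add_sub_cancel_right]
  have h4 : matNorm B ^ 2 ≤ K * matNorm B := by
    have := h3.le_of_lip' (C := K * matNorm B) (mul_nonneg hK (matNorm_nonneg _))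
      (Eventually.of_forall fun τ => ?_)
    · rwa [Real.norm_eq_abs, abs_of_nonneg (sq_nonneg _)] at this
    · have := hl (A + τ • B)
      simp only [zero_smul, add_zero, sub_zero, Real.norm_eq_abs]
      rw [add_sub_cancel_left, matNorm_smul] at this
      linarith
  rcases (matNorm_nonneg B).eq_or_lt with h0 | h0
  · rw [← h0]; exact hK
  · exact le_of_mul_le_mul_right (by rwa [← sq]) h0

variable {d h : ℕ}

/-- With the target frozen, the loss depends on the encoder only through `W A`, and `A ↦ W A` is
`‖W‖`-Lipschitz for the Frobenius norm. -/
lemma matNorm_grad_encoder_le {σ ρ : ℝ} {Φ GΦ : Matrix (Fin h) (Fin d) ℝ}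
    {W : Matrix (Fin h) (Fin h) ℝ}
    (hG : IsGradOn (fun A => regLoss σ ρ A W Φ) ⊤ Φ GΦ)
    (hA : 2 * opNorm (W * Φ) ^ 2 < matNorm (W * Φ) ^ 2) :
    matNorm (GΦ - ρ • Φ) ≤
      2 * √(matNorm (W * Φ) ^ 2 - 2 * opNorm (W * Φ) ^ 2)⁻¹ * opNorm W := by
  refine matNorm_grad_sub_le (l := fun A => cosLoss σ A W Φ) (c := ρ / 2 * frobNorm W ^ 2)
    Submodule.mem_top hG (mul_nonneg (by positivity) (opNorm_nonneg _))
    (fun B => by simp only [regLoss]; ring) fun B => ?_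
  refine (abs_cosLoss_sub_le σ Φ hA).trans ?_
  rw [← Matrix.mul_sub, mul_assoc _ (opNorm W)]
  exact mul_le_mul_of_nonneg_left (matNorm_mul_le_left _ _) (by positivity)

lemma matNorm_grad_head_le {σ ρ : ℝ} {Φ : Matrix (Fin h) (Fin d) ℝ}
    {W GW : Matrix (Fin h) (Fin h) ℝ} {S : Submodule ℝ (Matrix (Fin h) (Fin h) ℝ)} (hW : W ∈ S)
    (hG : IsGradOn (fun B => regLoss σ ρ Φ B Φ) S W GW)
    (hA : 2 * opNorm (W * Φ) ^ 2 < matNorm (W * Φ) ^ 2) :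
    matNorm (GW - ρ • W) ≤
      2 * √(matNorm (W * Φ) ^ 2 - 2 * opNorm (W * Φ) ^ 2)⁻¹ * opNorm Φ := by
  refine matNorm_grad_sub_le (l := fun B => cosLoss σ Φ B Φ) (c := ρ / 2 * frobNorm Φ ^ 2)
    hW hG (mul_nonneg (by positivity) (opNorm_nonneg _))
    (fun B => by simp only [regLoss]; ring) fun B => ?_
  refine (abs_cosLoss_sub_le σ Φ hA).trans ?_
  rw [← Matrix.sub_mul, mul_assoc _ (opNorm Φ), mul_comm (opNorm Φ)]
  exact mul_le_mul_of_nonneg_left (matNorm_mul_le_right _ _) (by positivity)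

lemma matNorm_mul_sub_mul_le {A A' : Matrix (Fin h) (Fin h) ℝ} {B B' : Matrix (Fin h) (Fin d) ℝ}
    {M δ : ℝ} (hδ : 0 ≤ δ) (hA : opNorm A ≤ M) (hB : opNorm B ≤ M)
    (hA' : matNorm (A' - A) ≤ δ) (hB' : matNorm (B' - B) ≤ δ) :
    matNorm (A' * B' - A * B) ≤ (2 * M + δ) * δ := by
  have e : A' * B' - A * B = A' * (B' - B) + (A' - A) * B := by
    rw [Matrix.mul_sub, Matrix.sub_mul]; abel
  have hA1 : opNorm A' ≤ M + δ := by
    have := opNorm_add_le A (A' - A)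
    rw [add_sub_cancel] at this
    linarith [opNorm_le_matNorm (A' - A)]
  rw [e]
  calc _ ≤ opNorm A' * matNorm (B' - B) + matNorm (A' - A) * opNorm B :=
        (matNorm_add_le _ _).trans (add_le_add (matNorm_mul_le_left _ _) (matNorm_mul_le_right _ _))
    _ ≤ (M + δ) * δ + δ * M := by
        refine add_le_add ?_ ?_
        · exact mul_le_mul hA1 hB' (matNorm_nonneg _) ((opNorm_nonneg _).trans hA1)
        · exact mul_le_mul hA' hB (opNorm_nonneg _) hδ
    _ = _ := by ring

lemma opNorm_le_of_matNorm_sub_le {κ ι : Type*} [Fintype κ] [Fintype ι] {A A' : Matrix κ ι ℝ}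
    {M δ : ℝ} (hA : opNorm A ≤ M) (hA' : matNorm (A' - A) ≤ δ) : opNorm A' ≤ M + δ := by
  have := opNorm_add_le A (A' - A)
  rw [add_sub_cancel] at this
  linarith [opNorm_le_matNorm (A' - A)]

/-- The margin `‖W Φ‖_F² - 2 ‖W Φ‖²` is preserved, up to the decay, near the initial values. -/
lemma margin_le_of_close {M Q r : ℝ} {Φ₀ Φ : Matrix (Fin h) (Fin d) ℝ}
    {W₀ W : Matrix (Fin h) (Fin h) ℝ} (hr : 0 < r)
    (hΦ₀ : opNorm Φ₀ ≤ M) (hW₀ : opNorm W₀ ≤ M) (hF : 2 * M + 1 ≤ matNorm (W₀ * Φ₀))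
    (hQ : Q ≤ (matNorm (W₀ * Φ₀) - (2 * M + 1)) ^ 2 - 2 * (M + 1) ^ 4)
    (hΦ : matNorm (r • Φ - Φ₀) ≤ 1) (hW : matNorm (r • W - W₀) ≤ 1) :
    Q * (r ^ 4)⁻¹ ≤ matNorm (W * Φ) ^ 2 - 2 * opNorm (W * Φ) ^ 2 := by
  -- Distance `1` in each factor moves the product by at most `2 M + 1` in Frobenius norm, and
  -- raises each operator norm to at most `M + 1`.
  have h1 := matNorm_mul_sub_mul_le zero_le_one hW₀ hΦ₀ hW hΦ
  have e : (r • W) * (r • Φ) = r ^ 2 • (W * Φ) := by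
    rw [Matrix.smul_mul, Matrix.mul_smul, smul_smul, sq]
  have h2 : matNorm (W₀ * Φ₀) - (2 * M + 1) ≤ r ^ 2 * matNorm (W * Φ) := by
    rw [e] at h1
    have := abs_le.1 ((abs_matNorm_sub_le _ _).trans h1)
    rw [matNorm_smul, abs_of_pos (by positivity)] at this
    linarith [this.1]
  have h3 : r ^ 2 * opNorm (W * Φ) ≤ (M + 1) ^ 2 := by
    have e' : W * Φ = (r ^ 2)⁻¹ • ((r • W) * (r • Φ)) := by
      rw [e, smul_smul, inv_mul_cancel₀ (by positivity), one_smul]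
    have h4 : opNorm ((r • W) * (r • Φ)) ≤ (M + 1) ^ 2 := by
      have hw := opNorm_le_of_matNorm_sub_le hW₀ hW
      refine (opNorm_mul_le _ _).trans ?_
      rw [sq]
      exact mul_le_mul hw (opNorm_le_of_matNorm_sub_le hΦ₀ hΦ) (opNorm_nonneg _)
        ((opNorm_nonneg _).trans hw)
    have h5 := opNorm_smul_le (r ^ 2)⁻¹ ((r • W) * (r • Φ))
    rw [← e', abs_of_pos (by positivity)] at h5
    calc r ^ 2 * opNorm (W * Φ) ≤ r ^ 2 * ((r ^ 2)⁻¹ * opNorm ((r • W) * (r • Φ))) :=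
          mul_le_mul_of_nonneg_left h5 (by positivity)
      _ = opNorm ((r • W) * (r • Φ)) := by rw [mul_inv_cancel_left₀ (by positivity)]
      _ ≤ _ := h4
  rw [← div_eq_mul_inv, div_le_iff₀ (by positivity)]
  have h5 := pow_le_pow_left₀ (by linarith) h2 2
  have h6 := pow_le_pow_left₀ (mul_nonneg (by positivity) (opNorm_nonneg _)) h3 2
  nlinarith

/-- Up to the exponential decay, the gradient flow stays close to its initial value. -/
lemma IsGradientFlow.matNorm_exp_smul_sub_le {σ ρ T M Q ε : ℝ}
    {S : Submodule ℝ (Matrix (Fin h) (Fin h) ℝ)}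
    {Φ : ℝ → Matrix (Fin h) (Fin d) ℝ} {W : ℝ → Matrix (Fin h) (Fin h) ℝ}
    (hflow : IsGradientFlow σ ρ S T Φ W) (hρ : 0 < ρ) (hT : 0 ≤ T) (hε : 0 < ε) (hε1 : ε ≤ 1)
    (hΦ₀ : opNorm (Φ 0) ≤ M) (hW₀ : opNorm (W 0) ≤ M)
    (hF : 2 * M + 1 ≤ matNorm (W 0 * Φ 0)) (hQ : 0 < Q)
    (hQF : Q ≤ (matNorm (W 0 * Φ 0) - (2 * M + 1)) ^ 2 - 2 * (M + 1) ^ 4)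
    (hslope : 2 * Real.exp (2 * ρ * T) * (M + 1) * (√Q)⁻¹ < ε / (T + 1)) :
    ∀ s ∈ Set.Icc 0 T, matNorm (Real.exp (ρ * s) • Φ s - Φ 0) ≤ ε ∧
      matNorm (Real.exp (ρ * s) • W s - W 0) ≤ ε := by
  have hM : 0 ≤ M := (opNorm_nonneg _).trans hΦ₀
  choose! hWS GΦ GW hGΦ hGW hdΦ hdW using hflow
  -- The integrating factor `exp (ρ s)` cancels the decay, so `f'` contains only the loss gradient.
  -- Euclidean coordinates make the product norm of `f` the maximum of the two Frobenius distances.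
  set f : ℝ → EuclideanSpace ℝ (Fin h × Fin d) × EuclideanSpace ℝ (Fin h × Fin h) := fun s =>
    (matVec (Real.exp (ρ * s) • Φ s - Φ 0), matVec (Real.exp (ρ * s) • W s - W 0)) with hf
  set f' : ℝ → EuclideanSpace ℝ (Fin h × Fin d) × EuclideanSpace ℝ (Fin h × Fin h) := fun s =>
    (matVec (Real.exp (ρ * s) • -(GΦ s - ρ • Φ s)),
      matVec (Real.exp (ρ * s) • -(GW s - ρ • W s))) with hf'
  have hnorm : ∀ s, ‖f s‖ = max (matNorm (Real.exp (ρ * s) • Φ s - Φ 0))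
      (matNorm (Real.exp (ρ * s) • W s - W 0)) := fun s => rfl
  have hexp : ∀ s, HasDerivAt (fun s => Real.exp (ρ * s)) (Real.exp (ρ * s) * ρ) s := fun s => by
    simpa using ((hasDerivAt_id' s).const_mul ρ).exp
  have hderiv : ∀ s ∈ Set.Icc 0 T, HasDerivWithinAt f (f' s) (Set.Icc 0 T) s := fun s hs => by
    refine HasDerivWithinAt.prodMk ?_ ?_
    · refine (matVec.hasFDerivAt.comp_hasDerivWithinAt s
        (((hexp s).hasDerivWithinAt.fun_smul (hdΦ s hs)).sub_const (Φ 0))).congr_deriv ?_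
      congr 1
      rw [neg_sub, smul_sub, smul_smul, smul_neg]; abel
    · refine (matVec.hasFDerivAt.comp_hasDerivWithinAt s
        (((hexp s).hasDerivWithinAt.fun_smul (hdW s hs)).sub_const (W 0))).congr_deriv ?_
      congr 1
      rw [neg_sub, smul_sub, smul_smul, smul_neg]; abel
  have hb : 0 < ε / (T + 1) := by positivity
  have hbs : ∀ s ∈ Set.Icc 0 T, ε / (T + 1) * s ≤ ε := fun s hs => by
    rw [div_mul_eq_mul_div, div_le_iff₀ (by positivity)]
    exact mul_le_mul_of_nonneg_left (by linarith [hs.2]) hε.le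
  -- Linear barrier: the speed has to be bounded only at times when `‖f s‖` equals `ε s / (T + 1)`.
  -- There both distances are at most `ε ≤ 1`, so the margin needed for the gradient bound holds.
  -- Dividing by `T + 1` also covers `T = 0`.
  have main := image_norm_le_of_norm_deriv_right_lt_deriv_boundary (f := f) (f' := f')
    (a := 0) (b := T) (B := fun s => ε / (T + 1) * s) (B' := fun _ => ε / (T + 1))
    (fun s hs => (hderiv s hs).continuousWithinAt)
    (fun s hs => (hderiv s (Set.Ico_subset_Icc_self hs)).mono_of_mem_nhdsWithin
      (Icc_mem_nhdsGE_of_mem hs))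
    (by rw [hnorm]; simp [matNorm, vecNorm_zero, ← Pi.zero_def])
    (fun s => by simpa using (hasDerivAt_id' s).const_mul (ε / (T + 1)))
    (fun s hs heq => ?_)
  · intro s hs
    have h1 := (main hs).trans (hbs s hs)
    rw [hnorm, max_le_iff] at h1
    exact h1
  · have hs' := Set.Ico_subset_Icc_self hs
    have h1 : ‖f s‖ ≤ 1 := by rw [heq]; exact (hbs s hs').trans hε1
    rw [hnorm, max_le_iff] at h1
    obtain ⟨h1Φ, h1W⟩ := h1
    set r := Real.exp (ρ * s) with hr
    have hr0 : 0 < r := Real.exp_pos _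
    have hmar := margin_le_of_close hr0 hΦ₀ hW₀ hF hQF h1Φ h1W
    have hpos : 0 < Q * (r ^ 4)⁻¹ := by positivity
    have hA : 2 * opNorm (W s * Φ s) ^ 2 < matNorm (W s * Φ s) ^ 2 := by linarith
    have hsq : √(matNorm (W s * Φ s) ^ 2 - 2 * opNorm (W s * Φ s) ^ 2)⁻¹ ≤ r ^ 2 * (√Q)⁻¹ := by
      calc _ ≤ √(Q * (r ^ 4)⁻¹)⁻¹ := Real.sqrt_le_sqrt (inv_anti₀ hpos hmar)
        _ = √((r ^ 2) ^ 2 * Q⁻¹) := by congr 1; rw [mul_inv, inv_inv]; ring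
        _ = _ := by rw [Real.sqrt_mul (by positivity), Real.sqrt_sq (by positivity), Real.sqrt_inv]
    have hr2 : r ^ 2 ≤ Real.exp (2 * ρ * T) := by
      rw [hr, ← Real.exp_nat_mul]
      refine Real.exp_le_exp.2 ?_
      push_cast
      nlinarith [hs.2]
    -- Common to both parameters: with `r = exp (ρ s)`, one has `r ‖A‖ ≤ M + 1`, and the inverse
    -- margin contributes `r² / √Q`. This explains the left side of `hslope`.
    have key : ∀ {κ ι : Type} [Fintype κ] [Fintype ι] {A A₀ : Matrix κ ι ℝ} {x : ℝ},
        opNorm A₀ ≤ M → matNorm (r • A - A₀) ≤ 1 →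
        x ≤ 2 * √(matNorm (W s * Φ s) ^ 2 - 2 * opNorm (W s * Φ s) ^ 2)⁻¹ * opNorm A →
        r * x < ε / (T + 1) := by
      intro κ ι _ _ A A₀ x hA₀ hAA hx
      have hop : r * opNorm A ≤ M + 1 := by
        have h2 := opNorm_smul_le r⁻¹ (r • A)
        rw [smul_smul, inv_mul_cancel₀ hr0.ne', one_smul, abs_of_pos (inv_pos.2 hr0)] at h2
        calc r * opNorm A ≤ r * (r⁻¹ * opNorm (r • A)) := mul_le_mul_of_nonneg_left h2 hr0.le
          _ = opNorm (r • A) := mul_inv_cancel_left₀ hr0.ne' _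
          _ ≤ _ := opNorm_le_of_matNorm_sub_le hA₀ hAA
      refine lt_of_le_of_lt ?_ hslope
      calc r * x ≤ r * (2 * (r ^ 2 * (√Q)⁻¹) * opNorm A) := by
            refine mul_le_mul_of_nonneg_left (hx.trans ?_) hr0.le
            exact mul_le_mul_of_nonneg_right (mul_le_mul_of_nonneg_left hsq zero_le_two)
              (opNorm_nonneg _)
        _ = 2 * r ^ 2 * (r * opNorm A) * (√Q)⁻¹ := by ring
        _ ≤ 2 * Real.exp (2 * ρ * T) * (M + 1) * (√Q)⁻¹ := by
            gcongr
            exact mul_nonneg hr0.le (opNorm_nonneg _)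
    have hn : ∀ {κ ι : Type} [Fintype κ] [Fintype ι] (A : Matrix κ ι ℝ),
        ‖matVec (r • -A)‖ = r * matNorm A := fun A => by
      rw [norm_matVec, matNorm_smul, matNorm_neg, abs_of_pos hr0]
    change max ‖matVec (r • -(GΦ s - ρ • Φ s))‖ ‖matVec (r • -(GW s - ρ • W s))‖ < ε / (T + 1)
    rw [hn, hn, max_lt_iff]
    exact ⟨key hW₀ h1W (matNorm_grad_encoder_le (hGΦ s hs') hA),
      key hΦ₀ h1Φ (matNorm_grad_head_le (hWS s hs') (hGW s hs') hA)⟩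

end GradientFlow

/-! ### Nets of the unit ball. -/

section Nets

variable {ι κ : Type*} [Fintype ι] [Fintype κ]

/-- The Euclidean unit ball has a `1/2`-net of cardinality at most `5 ^ n`. -/
lemma exists_half_net (ι : Type*) [Fintype ι] : ∃ s : Finset (ι → ℝ), s.card ≤ 5 ^ Fintype.card ι ∧
    (∀ w ∈ s, vecNorm w ≤ 1) ∧ ∀ v, vecNorm v ≤ 1 → ∃ w ∈ s, vecNorm (v - w) ≤ 1 / 2 := by
  classical
  set E := EuclideanSpace ℝ ι
  -- A maximal `1`-separated subset of the ball of radius `2` is a `1`-net of it; halving it gives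
  -- the required net. This scale is the one for which the packing bound is `5 ^ n`.
  let sep : Finset E → Prop := fun s =>
    (∀ c ∈ s, ‖c‖ ≤ 2) ∧ ∀ c ∈ s, ∀ c' ∈ s, c ≠ c' → 1 ≤ ‖c - c'‖
  have hcard : ∀ s, sep s → s.card ≤ 5 ^ Fintype.card ι := fun s hs => by
    simpa [E] using Besicovitch.card_le_of_separated s hs.1 hs.2
  obtain ⟨s, hs, hmax⟩ : ∃ s, sep s ∧ ∀ s', sep s' → s'.card ≤ s.card := by
    have hbdd : BddAbove {n | ∃ s, sep s ∧ s.card = n} :=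
      ⟨5 ^ Fintype.card ι, by rintro _ ⟨s, hs, rfl⟩; exact hcard s hs⟩
    have hne : {n | ∃ s, sep s ∧ s.card = n}.Nonempty := ⟨0, ∅, by simp [sep], rfl⟩
    obtain ⟨s, hs, he⟩ := Nat.sSup_mem hne hbdd
    exact ⟨s, hs, fun s' hs' => he ▸ le_csSup hbdd ⟨s', hs', rfl⟩⟩
  refine ⟨s.image fun c => ((1 / 2 : ℝ) • c).ofLp, Finset.card_image_le.trans (hcard s hs), ?_, ?_⟩
  · intro w hw
    obtain ⟨c, hc, rfl⟩ := Finset.mem_image.1 hw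
    have : vecNorm ((1 / 2 : ℝ) • c).ofLp = 1 / 2 * ‖c‖ := by
      change ‖(1 / 2 : ℝ) • c‖ = _
      rw [norm_smul]; norm_num
    rw [this]
    linarith [hs.1 c hc]
  · intro v hv
    set u : E := (2 : ℝ) • WithLp.toLp 2 v with hu
    have hu2 : ‖u‖ ≤ 2 := by
      rw [hu, norm_smul]
      change ‖(2 : ℝ)‖ * vecNorm v ≤ 2
      norm_num
      exact hv
    obtain ⟨c, hc, hcu⟩ : ∃ c ∈ s, ‖u - c‖ ≤ 1 := by
      by_contra! hcon
      have hus : u ∉ s := fun h => by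
        have := hcon u h
        simp at this
        linarith
      have hins : sep (insert u s) := by
        refine ⟨fun c hc => ?_, fun c hc c' hc' hne => ?_⟩
        · rcases Finset.mem_insert.1 hc with rfl | hc
          exacts [hu2, hs.1 c hc]
        · rcases Finset.mem_insert.1 hc with rfl | hc <;>
            rcases Finset.mem_insert.1 hc' with rfl | hc'
          · exact absurd rfl hne
          · exact (hcon c' hc').le
          · rw [norm_sub_rev]; exact (hcon c hc).le
          · exact hs.2 c hc c' hc' hne
      have := hmax _ hins
      rw [Finset.card_insert_of_notMem hus] at this
      omega
    refine ⟨_, Finset.mem_image_of_mem _ hc, ?_⟩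
    have : WithLp.toLp 2 v - (1 / 2 : ℝ) • c = (1 / 2 : ℝ) • (u - c) := by
      rw [hu, smul_sub, smul_smul]; norm_num
    change ‖WithLp.toLp 2 v - (1 / 2 : ℝ) • c‖ ≤ 1 / 2
    rw [this, norm_smul]
    norm_num
    linarith

lemma vecNorm_inv_smul_le_one {v : ι → ℝ} (hv : 0 < vecNorm v) :
    vecNorm ((vecNorm v)⁻¹ • v) ≤ 1 := by
  rw [vecNorm_smul, abs_of_pos (inv_pos.2 hv), inv_mul_cancel₀ hv.ne']

/-- Each net costs a factor `2`: the supremum over a ball is at most the supremum over the net plus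
half of itself. A one-sided bound on the bilinear form suffices, since `p` is chosen close to the
direction of `A q`. -/
lemma opNorm_le_of_half_nets {A : Matrix κ ι ℝ} {τ : ℝ} {s : Finset (ι → ℝ)} {t : Finset (κ → ℝ)}
    (hs : ∀ v, vecNorm v ≤ 1 → ∃ w ∈ s, vecNorm (v - w) ≤ 1 / 2)
    (ht : ∀ v, vecNorm v ≤ 1 → ∃ w ∈ t, vecNorm (v - w) ≤ 1 / 2)
    (h : ∀ p ∈ t, ∀ q ∈ s, p ⬝ᵥ (A *ᵥ q) ≤ τ) : opNorm A ≤ 4 * τ := by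
  have h1 : ∀ q ∈ s, vecNorm (A *ᵥ q) ≤ 2 * τ := fun q hq => by
    rcases (vecNorm_nonneg (A *ᵥ q)).eq_or_lt with h0 | h0
    · obtain ⟨p, hp, -⟩ := ht 0 (by rw [vecNorm_zero]; exact zero_le_one)
      have := h p hp q hq
      rw [vecNorm_eq_zero.1 h0.symm, dotProduct_zero] at this
      rw [← h0]; linarith
    · obtain ⟨p, hp, hpv⟩ := ht _ (vecNorm_inv_smul_le_one h0)
      set v := A *ᵥ q
      have e : vecNorm v = p ⬝ᵥ v + ((vecNorm v)⁻¹ • v - p) ⬝ᵥ v := by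
        rw [sub_dotProduct, smul_dotProduct, ← vecNorm_sq_eq_dotProduct, smul_eq_mul, sq,
          inv_mul_cancel_left₀ h0.ne']
        ring
      have h2 := (le_abs_self _).trans (abs_dotProduct_le ((vecNorm v)⁻¹ • v - p) v)
      have h3 := mul_le_mul_of_nonneg_right hpv h0.le
      linarith [h p hp q hq]
  have h0τ : 0 ≤ τ := by
    obtain ⟨q, hq, -⟩ := hs 0 (by rw [vecNorm_zero]; exact zero_le_one)
    linarith [vecNorm_nonneg (A *ᵥ q), h1 q hq]
  have h2 : opNorm A ≤ 2 * τ + opNorm A * (1 / 2) := by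
    refine opNorm_le (add_nonneg (by linarith) (mul_nonneg (opNorm_nonneg _) (by norm_num)))
      fun v => ?_
    rcases (vecNorm_nonneg v).eq_or_lt with h0 | h0
    · rw [vecNorm_eq_zero.1 h0.symm, mulVec_zero, vecNorm_zero, vecNorm_zero, mul_zero]
    · obtain ⟨q, hq, hqv⟩ := hs _ (vecNorm_inv_smul_le_one h0)
      set u := (vecNorm v)⁻¹ • v with hu
      have hv : v = vecNorm v • u := by rw [hu, smul_smul, mul_inv_cancel₀ h0.ne', one_smul]
      have h3 : vecNorm (A *ᵥ u) ≤ 2 * τ + opNorm A * (1 / 2) := by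
        have e : A *ᵥ u = A *ᵥ q + A *ᵥ (u - q) := by rw [← mulVec_add, add_sub_cancel]
        rw [e]
        refine (vecNorm_add_le _ _).trans (add_le_add (h1 q hq) ?_)
        exact (vecNorm_mulVec_le _ _).trans (mul_le_mul_of_nonneg_left hqv (opNorm_nonneg _))
      calc vecNorm (A *ᵥ v) = vecNorm v * vecNorm (A *ᵥ u) := by
            conv_lhs => rw [hv, mulVec_smul, vecNorm_smul, abs_of_pos h0]
        _ ≤ _ := by rw [mul_comm]; exact mul_le_mul_of_nonneg_right h3 h0.le
  linarith

end Nets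

/-! ### Operator norms of random matrices and conditional concentration. -/

section RandomMatrix

variable {Ω : Type*} [MeasurableSpace Ω] {P : Measure Ω}

lemma ProbabilityTheory.HasSubgaussianMGF.mono {X : Ω → ℝ} {c c' : NNReal}
    (h : HasSubgaussianMGF X c P) (hc : c ≤ c') : HasSubgaussianMGF X c' P :=
  ⟨h.integrable_exp_mul, fun t => (h.mgf_le t).trans (Real.exp_le_exp.2 (by gcongr))⟩

lemma hasSubgaussianMGF_of_sqrt_mul_gaussian {X : Ω → ℝ} {N : ℕ} (hN : 0 < N)
    (hX : HasLaw (fun ω => √N * X ω) (gaussianReal 0 1) P) :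
    HasSubgaussianMGF X (N : NNReal)⁻¹ P := by
  have h1 : HasSubgaussianMGF (fun ω => √N * X ω) 1 P := by
    refine ⟨fun t => ?_, fun t => ?_⟩
    · have := integrable_exp_mul_gaussianReal (μ := 0) (v := 1) t
      rw [← hX.map_eq] at this
      exact this.comp_aemeasurable hX.aemeasurable
    · rw [mgf_gaussianReal hX.map_eq]; simp
  have hN' : 0 < √(N : ℝ) := Real.sqrt_pos.2 (Nat.cast_pos.2 hN)
  have h2 := (h1.const_mul (√N)⁻¹).congr (ae_of_all _ fun ω => inv_mul_cancel_left₀ hN'.ne' (X ω))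
  refine h2.mono (le_of_eq (NNReal.eq ?_))
  change (√(N : ℝ))⁻¹ ^ 2 * 1 = ((N : NNReal)⁻¹ : NNReal)
  simp [inv_pow]

variable {ι κ : Type*} [Fintype ι] [Fintype κ] [IsProbabilityMeasure P]

/-- Operator norm of a random matrix with independent sub-Gaussian entries on `J` and zeros
elsewhere. -/
lemma measure_lt_opNorm_le {X : Ω → Matrix κ ι ℝ} {J : Set (κ × ι)} {c : NNReal} {τ : ℝ}
    (hind : iIndepFun (fun (e : J) ω => X ω e.1.1 e.1.2) P)
    (hsub : ∀ e ∈ J, HasSubgaussianMGF (fun ω => X ω e.1 e.2) c P)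
    (h0 : ∀ ω, ∀ e ∉ J, X ω e.1 e.2 = 0) (hτ : 0 ≤ τ) :
    P {ω | 4 * τ < opNorm (X ω)} ≤
      ENNReal.ofReal (5 ^ (Fintype.card κ + Fintype.card ι) * Real.exp (-τ ^ 2 / (2 * c))) := by
  classical
  obtain ⟨s, hsc, hs1, hs⟩ := exists_half_net ι
  obtain ⟨t, htc, ht1, ht⟩ := exists_half_net κ
  have hsum : ∀ p q ω, p ⬝ᵥ (X ω *ᵥ q) = ∑ e : J, (p e.1.1 * q e.1.2) * X ω e.1.1 e.1.2 := by
    intro p q ω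
    have e1 : p ⬝ᵥ (X ω *ᵥ q) = ∑ e : κ × ι, (p e.1 * q e.2) * X ω e.1 e.2 := by
      rw [Fintype.sum_prod_type]
      simp only [dotProduct, mulVec, Finset.mul_sum]
      exact Finset.sum_congr rfl fun i _ => Finset.sum_congr rfl fun j _ => by ring
    rw [e1, ← Finset.sum_subtype (Finset.univ.filter (· ∈ J)) (by simp)
      fun e : κ × ι => (p e.1 * q e.2) * X ω e.1 e.2, Finset.sum_filter_of_ne]
    intro e _ he
    by_contra hJ
    exact he (by rw [h0 ω e hJ, mul_zero])
  have htail : ∀ p ∈ t, ∀ q ∈ s, P {ω | τ ≤ p ⬝ᵥ (X ω *ᵥ q)} ≤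
      ENNReal.ofReal (Real.exp (-τ ^ 2 / (2 * c))) := by
    intro p hp q hq
    have hi := hind.comp (fun (e : J) x => (p e.1.1 * q e.1.2) * x) (fun e => by fun_prop)
    have hS := HasSubgaussianMGF.sum_of_iIndepFun hi (s := Finset.univ)
      (fun e _ => (hsub e.1 e.2).const_mul (p e.1.1 * q e.1.2))
    -- The weights satisfy `∑ (p_i q_j)² ≤ |p|² |q|² ≤ 1`, so the weighted sum keeps the variance
    -- proxy `c`.
    have hc : ∑ e : J, (NNReal.mk ((p e.1.1 * q e.1.2) ^ 2) (sq_nonneg _)) * c ≤ c := by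
      rw [← Finset.sum_mul]
      refine mul_le_of_le_one_left zero_le ?_
      rw [← NNReal.coe_le_coe]
      push_cast
      calc ∑ e : J, (p e.1.1 * q e.1.2) ^ 2
          = ∑ e ∈ Finset.univ.filter (· ∈ J), (p e.1 * q e.2) ^ 2 :=
            (Finset.sum_subtype _ (by simp) fun e : κ × ι => (p e.1 * q e.2) ^ 2).symm
        _ ≤ ∑ e : κ × ι, (p e.1 * q e.2) ^ 2 :=
            Finset.sum_le_sum_of_subset_of_nonneg (Finset.filter_subset _ _)
              fun _ _ _ => sq_nonneg _
        _ = vecNorm p ^ 2 * vecNorm q ^ 2 := by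
            rw [vecNorm_sq, vecNorm_sq, Fintype.sum_prod_type, Finset.sum_mul_sum]
            exact Finset.sum_congr rfl fun i _ => Finset.sum_congr rfl fun j _ => mul_pow _ _ _
        _ ≤ 1 := mul_le_one₀ (pow_le_one₀ (vecNorm_nonneg _) (ht1 p hp)) (sq_nonneg _)
            (pow_le_one₀ (vecNorm_nonneg _) (hs1 q hq))
    have := (hS.mono hc).measure_ge_le hτ
    simp_rw [hsum]
    rw [← ofReal_measureReal]
    exact ENNReal.ofReal_le_ofReal this
  have hsubset : {ω | 4 * τ < opNorm (X ω)} ⊆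
      ⋃ e ∈ t ×ˢ s, {ω | τ ≤ e.1 ⬝ᵥ (X ω *ᵥ e.2)} := by
    intro ω hω
    by_contra hcon
    simp only [Set.mem_iUnion, not_exists, Finset.mem_product] at hcon
    refine absurd (opNorm_le_of_half_nets hs ht fun p hp q hq => ?_) (not_le.2 hω)
    exact (not_le.1 (hcon (p, q) ⟨hp, hq⟩)).le
  calc _ ≤ P (⋃ e ∈ t ×ˢ s, {ω | τ ≤ e.1 ⬝ᵥ (X ω *ᵥ e.2)}) := measure_mono hsubset
    _ ≤ ∑ e ∈ t ×ˢ s, P {ω | τ ≤ e.1 ⬝ᵥ (X ω *ᵥ e.2)} := measure_biUnion_finset_le _ _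
    _ ≤ ∑ _e ∈ t ×ˢ s, ENNReal.ofReal (Real.exp (-τ ^ 2 / (2 * c))) :=
        Finset.sum_le_sum fun e he =>
          htail e.1 (Finset.mem_product.1 he).1 e.2 (Finset.mem_product.1 he).2
    _ = ENNReal.ofReal ((t.card * s.card : ℕ) * Real.exp (-τ ^ 2 / (2 * c))) := by
        rw [Finset.sum_const, Finset.card_product, nsmul_eq_mul,
          ENNReal.ofReal_mul (Nat.cast_nonneg _), ENNReal.ofReal_natCast]
    _ ≤ _ := by
        refine ENNReal.ofReal_le_ofReal (mul_le_mul_of_nonneg_right ?_ (Real.exp_pos _).le)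
        rw [pow_add]
        exact_mod_cast Nat.mul_le_mul htc hsc

/-- A matrix with independent centred Gaussian entries of variance `1 / N` has bounded operator
norm, when its dimensions are `O(N)`. -/
lemma measure_lt_opNorm_gaussian_le {X : Ω → Matrix κ ι ℝ} {J : Set (κ × ι)} {N : ℕ} {K : ℝ}
    (hN : 0 < N) (hK : 0 ≤ K) (hcard : ((Fintype.card κ + Fintype.card ι : ℕ) : ℝ) ≤ K * N)
    (hind : iIndepFun (fun (e : J) ω => X ω e.1.1 e.1.2) P)
    (hlaw : ∀ e ∈ J, HasLaw (fun ω => √N * X ω e.1 e.2) (gaussianReal 0 1) P)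
    (h0 : ∀ ω, ∀ e ∉ J, X ω e.1 e.2 = 0) :
    P {ω | 4 * √(2 * (2 * K + 1)) < opNorm (X ω)} ≤ ENNReal.ofReal (Real.exp (-N)) := by
  have hN' : (0 : ℝ) < N := Nat.cast_pos.2 hN
  refine (measure_lt_opNorm_le hind (fun e he => hasSubgaussianMGF_of_sqrt_mul_gaussian hN
    (hlaw e he)) h0 (Real.sqrt_nonneg _)).trans (ENNReal.ofReal_le_ofReal ?_)
  -- The pair of nets has at most `exp (2 K N)` elements, and the threshold makes each tail `exp
  -- (-(2 K + 1) N)`.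
  have h5 : (5 : ℝ) ≤ Real.exp 2 := by
    have h1 := Real.exp_one_gt_d9
    have h2 : Real.exp 2 = Real.exp 1 * Real.exp 1 := by rw [← Real.exp_add]; norm_num
    rw [h2]; nlinarith
  calc (5 : ℝ) ^ (Fintype.card κ + Fintype.card ι) * _
      ≤ Real.exp (2 * (K * N)) * Real.exp (-(2 * K + 1) * N) := by
        refine mul_le_mul ?_ (Real.exp_le_exp.2 (le_of_eq ?_)) (Real.exp_pos _).le
          (Real.exp_pos _).le
        · refine (pow_le_pow_left₀ (by norm_num) h5 _).trans ?_
          rw [← Real.exp_nat_mul]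
          refine Real.exp_le_exp.2 ?_
          linarith
        · rw [Real.sq_sqrt (by positivity)]
          push_cast
          field_simp
    _ = Real.exp (-N) := by rw [← Real.exp_add]; congr 1; ring

/-- Conditional concentration: a Gaussian vector hit by an independent random matrix. -/
lemma measure_opNorm_le_and_le_abs_sub_le {θ : Type*} [Fintype θ] {Y : Ω → θ → ℝ} {G : Ω → ι → ℝ}
    {A : (θ → ℝ) → Matrix κ ι ℝ} (hA : Continuous A) (hY : AEMeasurable Y P)
    (hG : AEMeasurable G P) (hind : IndepFun Y G P) (hlaw : P.map G = stdGauss ι)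
    (M : ℝ) {δ : ℝ} (hδ : 0 < δ) :
    P {ω | opNorm (A (Y ω)) ≤ M ∧ δ ≤ |vecNorm (A (Y ω) *ᵥ G ω) - matNorm (A (Y ω))|} ≤
      ENNReal.ofReal (8 * M ^ 2 / δ ^ 2) := by
  -- Fubini freezes `Y` by independence, then Chebyshev is used in `G`. Including `opNorm ≤ M` in
  -- the event makes the conditional bound uniform in `Y`.
  set T : Set ((θ → ℝ) × (ι → ℝ)) :=
    {p | opNorm (A p.1) ≤ M ∧ δ ≤ |vecNorm (A p.1 *ᵥ p.2) - matNorm (A p.1)|} with hT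
  have hA1 : Continuous fun p : (θ → ℝ) × (ι → ℝ) => A p.1 := hA.comp continuous_fst
  have hTm : MeasurableSet T := by
    refine IsClosed.measurableSet (IsClosed.inter ?_ ?_)
    · exact isClosed_le (continuous_opNorm.comp hA1) continuous_const
    · exact isClosed_le continuous_const (((continuous_vecNorm.comp
        (hA1.matrix_mulVec continuous_snd)).sub (continuous_matNorm.comp hA1)).abs)
  have : IsProbabilityMeasure (P.map Y) := Measure.isProbabilityMeasure_map hY
  calc _ = P.map (fun ω => (Y ω, G ω)) T := by
        rw [Measure.map_apply_of_aemeasurable (hY.prodMk hG) hTm]; rfl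
    _ = ((P.map Y).prod (stdGauss ι)) T := by rw [hind.map_prod_eq_prod_map_map hY hG, hlaw]
    _ = ∫⁻ y, stdGauss ι (Prod.mk y ⁻¹' T) ∂P.map Y := Measure.prod_apply hTm
    _ ≤ ∫⁻ _y, ENNReal.ofReal (8 * M ^ 2 / δ ^ 2) ∂P.map Y := by
        refine lintegral_mono fun y => ?_
        by_cases hy : opNorm (A y) ≤ M
        · have hsub : Prod.mk y ⁻¹' T ⊆ {g | ENNReal.ofReal (δ ^ 2) ≤
              ENNReal.ofReal ((vecNorm (A y *ᵥ g) - matNorm (A y)) ^ 2)} := fun g hg => by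
            refine ENNReal.ofReal_le_ofReal ?_
            rw [← sq_abs (vecNorm _ - _)]
            exact pow_le_pow_left₀ hδ.le hg.2 2
          refine (measure_mono hsub).trans ((meas_ge_le_lintegral_div ?_ ?_ ENNReal.ofReal_ne_top).trans ?_)
          · exact ((((continuous_vecNorm_mulVec (A y)).sub continuous_const).pow
              2).measurable.ennreal_ofReal).aemeasurable
          · simpa using hδ.ne'
          · rw [ENNReal.ofReal_div_of_pos (by positivity)]
            refine ENNReal.div_le_div_right ((lintegral_vecNorm_sub_matNorm_sq_le (A y)).trans ?_) _
            refine ENNReal.ofReal_le_ofReal ?_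
            have := pow_le_pow_left₀ (opNorm_nonneg _) hy 2
            linarith
        · have : Prod.mk y ⁻¹' T = ∅ := Set.eq_empty_of_forall_notMem fun g hg => hy hg.1
          rw [this, measure_empty]
          exact zero_le
    _ = _ := by rw [lintegral_const, measure_univ, mul_one]

lemma matNorm_one_sq (ι : Type*) [Fintype ι] [DecidableEq ι] :
    matNorm (1 : Matrix ι ι ℝ) ^ 2 = Fintype.card ι := by
  simp [matNorm_sq, one_apply]

/-- Concentration of the norm of a standard Gaussian vector. -/
lemma measure_le_abs_vecNorm_sub_sqrt_card_le {G : Ω → ι → ℝ} (hG : AEMeasurable G P)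
    (hlaw : P.map G = stdGauss ι) {δ : ℝ} (hδ : 0 < δ) :
    P {ω | δ ≤ |vecNorm (G ω) - √(Fintype.card ι)|} ≤ ENNReal.ofReal (8 / δ ^ 2) := by
  classical
  have h1 : opNorm (1 : Matrix ι ι ℝ) ≤ 1 := opNorm_le zero_le_one fun v => by
    rw [one_mulVec, one_mul]
  have h2 : matNorm (1 : Matrix ι ι ℝ) = √(Fintype.card ι) := by
    rw [← matNorm_one_sq, Real.sqrt_sq (matNorm_nonneg _)]
  have := measure_opNorm_le_and_le_abs_sub_le (P := P) (Y := fun _ (_ : Unit) => (0 : ℝ)) (G := G)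
    (A := fun _ => (1 : Matrix ι ι ℝ)) continuous_const aemeasurable_const hG
    (indepFun_const_left _ _) hlaw 1 hδ
  simp only [h1, h2, one_mulVec, true_and] at this
  simpa using this

end RandomMatrix

/-! ### Typical behaviour of the initialization. -/

section Initialization

variable {Ω : Type*} [MeasurableSpace Ω] {P : Measure Ω}

/-- Grouping two disjoint blocks of an independent family; measurable versions replace the almost
everywhere measurable functions. -/
lemma ProbabilityTheory.iIndepFun.indepFun_sum {α β : Type*} [Fintype α] [Fintype β]
    {Z : α ⊕ β → Ω → ℝ} (h : iIndepFun Z P) (hm : ∀ i, AEMeasurable (Z i) P) :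
    IndepFun (fun ω a => Z (Sum.inl a) ω) (fun ω b => Z (Sum.inr b) ω) P := by
  classical
  have h' : iIndepFun (fun i => (hm i).mk (Z i)) P := h.congr fun i => (hm i).ae_eq_mk
  let S : Finset (α ⊕ β) := Finset.univ.map Function.Embedding.inl
  let T : Finset (α ⊕ β) := Finset.univ.map Function.Embedding.inr
  have hS := h'.indepFun_finset S T (by simp [S, T, Finset.disjoint_left])
    (fun i => (hm i).measurable_mk)
  have hφ : Measurable fun (v : S → ℝ) (a : α) => v ⟨Sum.inl a, by simp [S]⟩ :=
    measurable_pi_iff.2 fun a => measurable_pi_apply _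
  have hψ : Measurable fun (v : T → ℝ) (b : β) => v ⟨Sum.inr b, by simp [T]⟩ :=
    measurable_pi_iff.2 fun b => measurable_pi_apply _
  have hc := hS.comp hφ hψ
  refine hc.congr ?_ ?_
  · have : ∀ᵐ ω ∂P, ∀ a, Z (Sum.inl a) ω = (hm (Sum.inl a)).mk _ ω :=
      ae_all_iff.2 fun a => (hm _).ae_eq_mk
    filter_upwards [this] with ω hω
    ext a; exact (hω a).symm
  · have : ∀ᵐ ω ∂P, ∀ b, Z (Sum.inr b) ω = (hm (Sum.inr b)).mk _ ω :=
      ae_all_iff.2 fun b => (hm _).ae_eq_mk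
    filter_upwards [this] with ω hω
    ext b; exact (hω b).symm

lemma map_eq_stdGauss {ι : Type*} [Fintype ι] [IsProbabilityMeasure P] {Z : ι → Ω → ℝ}
    (h : iIndepFun Z P) (hlaw : ∀ i, HasLaw (Z i) (gaussianReal 0 1) P) :
    P.map (fun ω i => Z i ω) = stdGauss ι := by
  rw [(iIndepFun_iff_map_fun_eq_pi_map fun i => (hlaw i).aemeasurable).1 h]
  simp_rw [fun i => (hlaw i).map_eq]

variable {d h : ℕ} {I : Set (Fin h × Fin h)} {Φ : Ω → Matrix (Fin h) (Fin d) ℝ}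
  {W : Ω → Matrix (Fin h) (Fin h) ℝ} {x₀ : Ω → Fin d → ℝ}

lemma aemeasurable_of_hasLaw_sqrt_mul {X : Ω → ℝ} {N : ℕ} (hN : 0 < N)
    (hX : HasLaw (fun ω => √N * X ω) (gaussianReal 0 1) P) : AEMeasurable X P := by
  have hN' : √(N : ℝ) ≠ 0 := (Real.sqrt_pos.2 (Nat.cast_pos.2 hN)).ne'
  refine (hX.aemeasurable.const_mul (√N)⁻¹).congr (ae_of_all _ fun ω => ?_)
  exact inv_mul_cancel_left₀ hN' _

namespace IsGaussianInit

lemma aemeasurable_encoder (hg : IsGaussianInit P I Φ W x₀) (i : Fin h) (j : Fin d) :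
    AEMeasurable (fun ω => Φ ω i j) P :=
  aemeasurable_of_hasLaw_sqrt_mul j.pos (hg.law_Φ i j)

lemma aemeasurable_head (hg : IsGaussianInit P I Φ W x₀) (i j : Fin h) :
    AEMeasurable (fun ω => W ω i j) P :=
  aemeasurable_of_hasLaw_sqrt_mul j.pos (hg.law_W i j)

lemma iIndepFun_encoder (hg : IsGaussianInit P I Φ W x₀) :
    iIndepFun (fun (p : Fin h × Fin d) ω => Φ ω p.1 p.2) P :=
  hg.indep.precomp Sum.inl_injective

lemma iIndepFun_head (hg : IsGaussianInit P I Φ W x₀) :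
    iIndepFun (fun (q : I) ω => W ω q.1.1 q.1.2) P :=
  hg.indep.precomp (Sum.inr_injective.comp Sum.inl_injective)

lemma indepFun_encoder_input (hg : IsGaussianInit P I Φ W x₀) :
    IndepFun (fun ω (p : Fin h × Fin d) => Φ ω p.1 p.2) x₀ P := by
  have h1 := hg.indep.precomp (g := Sum.map id (Sum.inr (α := I) (β := Fin d)))
    (Sum.map_injective.2 ⟨Function.injective_id, Sum.inr_injective⟩)
  refine h1.indepFun_sum ?_
  rintro (p | j)
  · exact hg.aemeasurable_encoder _ _
  · exact (hg.law_x₀ j).aemeasurable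

lemma indepFun_head_encoder (hg : IsGaussianInit P I Φ W x₀) :
    IndepFun (fun ω (q : I) => W ω q.1.1 q.1.2) (fun ω (p : Fin h × Fin d) => Φ ω p.1 p.2) P := by
  classical
  have h1 := hg.indep.precomp (g := Sum.elim (fun q : I => Sum.inr (Sum.inl q)) Sum.inl)
    (Function.Injective.sumElim (Sum.inr_injective.comp Sum.inl_injective) Sum.inl_injective
      (by simp))
  refine h1.indepFun_sum ?_
  rintro (q | p)
  · exact hg.aemeasurable_head _ _
  · exact hg.aemeasurable_encoder _ _

lemma map_input [IsProbabilityMeasure P] (hg : IsGaussianInit P I Φ W x₀) :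
    P.map x₀ = stdGauss (Fin d) :=
  map_eq_stdGauss (Z := fun j ω => x₀ ω j)
    (hg.indep.precomp (Sum.inr_injective.comp Sum.inr_injective)) hg.law_x₀

lemma map_encoder [IsProbabilityMeasure P] (hg : IsGaussianInit P I Φ W x₀) :
    P.map (fun ω (p : Fin h × Fin d) => √d * Φ ω p.1 p.2) = stdGauss (Fin h × Fin d) :=
  map_eq_stdGauss (hg.iIndepFun_encoder.comp (fun _ x => √d * x) fun _ => by fun_prop)
    fun p => hg.law_Φ p.1 p.2

lemma mono {J : Set (Fin h × Fin h)} (hg : IsGaussianInit P I Φ W x₀) (hJ : J ⊆ I) :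
    IsGaussianInit P J Φ W x₀ where
  law_Φ := hg.law_Φ
  law_W := hg.law_W
  law_x₀ := hg.law_x₀
  indep := by
    have := hg.indep.precomp (g := Sum.map id (Sum.map (Set.inclusion hJ) id))
      (Sum.map_injective.2 ⟨Function.injective_id, Sum.map_injective.2
        ⟨Set.inclusion_injective hJ, Function.injective_id⟩⟩)
    convert this using 1
    ext (p | q | j) <;> rfl

end IsGaussianInit

/-- Both initializations have independent entries on and above the diagonal, independent entries
below the diagonal, and a head independent of the encoder. -/
lemma indep_of_init
    (hinit : IsIIDInit P Φ W x₀ ∨ IsSymmetricInit P Φ W x₀) :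
    IsGaussianInit P {q | q.1 ≤ q.2} Φ W x₀ ∧
      iIndepFun (fun (q : {q : Fin h × Fin h | q.2 < q.1}) ω => W ω q.1.1 q.1.2) P ∧
      IndepFun (fun ω (q : Fin h × Fin h) => W ω q.1 q.2)
        (fun ω (p : Fin h × Fin d) => Φ ω p.1 p.2) P := by
  rcases hinit with hg | ⟨hs, hg⟩
  · refine ⟨hg.mono (Set.subset_univ _), (hg.mono (Set.subset_univ _)).iIndepFun_head, ?_⟩
    exact hg.indepFun_head_encoder.comp
      (φ := fun v (q : Fin h × Fin h) => v ⟨q, Set.mem_univ q⟩) (by fun_prop) measurable_id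
  · refine ⟨hg, ?_, ?_⟩
    · have h1 := hg.iIndepFun_head.precomp
        (g := fun q : {q : Fin h × Fin h | q.2 < q.1} =>
          (⟨(q.1.2, q.1.1), le_of_lt (show q.1.2 < q.1.1 from q.2)⟩ : {q : Fin h × Fin h | q.1 ≤ q.2}))
        (fun q q' hq => by
          have := congrArg Subtype.val hq
          simp only [Prod.mk.injEq] at this
          exact Subtype.ext (Prod.ext this.2 this.1))
      refine h1.congr fun q => ?_
      filter_upwards [hs] with ω hω
      exact hω.apply q.1.1 q.1.2
    · classical
      -- A symmetric head is almost surely a measurable function of its upper triangle, so it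
      -- inherits the independence from the encoder.
      have h1 := hg.indepFun_head_encoder.comp
        (φ := fun v (q : Fin h × Fin h) => if hq : q.1 ≤ q.2 then v ⟨q, hq⟩ else
          v ⟨(q.2, q.1), (le_of_not_ge hq)⟩) (measurable_pi_iff.2 fun q => by
            by_cases hq : q.1 ≤ q.2
            · simp only [hq, dite_true]; fun_prop
            · simp only [hq, dite_false]; fun_prop) measurable_id
      refine h1.congr ?_ (ae_eq_refl _)
      filter_upwards [hs] with ω hω
      ext q
      by_cases hq : q.1 ≤ q.2
      · simp [hq]
      · simp only [Function.comp_apply, hq, dite_false]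
        exact hω.apply q.1 q.2

/-- The matrix of `B ↦ A * B` acting on the entries of `B`. -/
def mulLeftMatrix {h : ℕ} (d : ℕ) (A : Matrix (Fin h) (Fin h) ℝ) :
    Matrix (Fin h × Fin d) (Fin h × Fin d) ℝ :=
  Matrix.of fun p q => if p.2 = q.2 then A p.1 q.1 else 0

lemma mulLeftMatrix_mulVec (A : Matrix (Fin h) (Fin h) ℝ) (v : Fin h × Fin d → ℝ) :
    mulLeftMatrix d A *ᵥ v =
      fun p => (A * (Matrix.of fun i j => v (i, j) : Matrix (Fin h) (Fin d) ℝ)) p.1 p.2 := by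
  ext p
  simp [mulLeftMatrix, mulVec, dotProduct, mul_apply, Fintype.sum_prod_type]

lemma vecNorm_mulLeftMatrix_mulVec (A : Matrix (Fin h) (Fin h) ℝ) (v : Fin h × Fin d → ℝ) :
    vecNorm (mulLeftMatrix d A *ᵥ v) =
      matNorm (A * (Matrix.of fun i j => v (i, j) : Matrix (Fin h) (Fin d) ℝ)) := by
  rw [mulLeftMatrix_mulVec]; rfl

lemma opNorm_mulLeftMatrix_le (A : Matrix (Fin h) (Fin h) ℝ) :
    opNorm (mulLeftMatrix d A) ≤ opNorm A :=
  opNorm_le (opNorm_nonneg _) fun v => by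
    rw [vecNorm_mulLeftMatrix_mulVec]
    exact matNorm_mul_le_left _ _

/-- The matrix consists of `d` diagonal copies of `A`. Together with `opNorm_mulLeftMatrix_le`, this
lets `√d ‖W Φ‖_F` be treated as the norm of a Gaussian vector concentrating around `√d ‖W‖_F`. -/
lemma matNorm_mulLeftMatrix (A : Matrix (Fin h) (Fin h) ℝ) :
    matNorm (mulLeftMatrix d A) = √d * matNorm A := by
  refine (pow_left_inj₀ (matNorm_nonneg _) (mul_nonneg (Real.sqrt_nonneg _) (matNorm_nonneg _))
    two_ne_zero).1 ?_
  rw [mul_pow, Real.sq_sqrt (Nat.cast_nonneg _), matNorm_sq, matNorm_sq]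
  simp only [mulLeftMatrix, of_apply, Fintype.sum_prod_type, ite_pow, ne_eq, OfNat.ofNat_ne_zero,
    not_false_eq_true, zero_pow, Finset.sum_ite_eq, Finset.mem_univ, if_true, Finset.sum_const,
    Finset.card_univ, Fintype.card_fin, nsmul_eq_mul, Finset.mul_sum]

/-- The upper triangle and its reflection cover the square. -/
lemma sq_le_two_mul_card_le (h : ℕ) :
    (h : ℝ) ^ 2 ≤ 2 * Fintype.card {q : Fin h × Fin h | q.1 ≤ q.2} := by
  classical
  have h1 : (Finset.univ : Finset (Fin h × Fin h)) ⊆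
      Finset.univ.filter (fun q => q.1 ≤ q.2) ∪
        (Finset.univ.filter (fun q : Fin h × Fin h => q.1 ≤ q.2)).image Prod.swap := fun q _ => by
    rcases le_total q.1 q.2 with hq | hq
    · simp [hq]
    · refine Finset.mem_union_right _ (Finset.mem_image.2 ⟨q.swap, by simpa using hq, by simp⟩)
  have h2 := (Finset.card_le_card h1).trans ((Finset.card_union_le _ _).trans
    (Nat.add_le_add_left Finset.card_image_le _))
  have h3 : Fintype.card {q : Fin h × Fin h | q.1 ≤ q.2} =
      (Finset.univ.filter fun q : Fin h × Fin h => q.1 ≤ q.2).card :=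
    Fintype.card_subtype _
  rw [h3]
  simp only [Finset.card_univ, Fintype.card_prod, Fintype.card_fin] at h2
  have : h ^ 2 ≤ 2 * (Finset.univ.filter fun q : Fin h × Fin h => q.1 ≤ q.2).card := by
    rw [sq]; omega
  exact_mod_cast this

/-- The properties of the initialization and the input that hold with high probability. -/
structure IsTypicalInit {d h : ℕ} (M η : ℝ) (Φ : Matrix (Fin h) (Fin d) ℝ)
    (W : Matrix (Fin h) (Fin h) ℝ) (x₀ : Fin d → ℝ) : Prop where
  opNorm_encoder : opNorm Φ ≤ M
  opNorm_head : opNorm W ≤ M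
  norm_input : vecNorm x₀ ≤ 2 * √d
  norm_image : |vecNorm (Φ *ᵥ x₀) - matNorm Φ| ≤ η * √h
  norm_product : √h / 2 - 1 ≤ matNorm (W * Φ)

/-- The entries of `A` at positions in `J`, and zero elsewhere. -/
noncomputable def restrictEntries {κ ι : Type*} (J : Set (κ × ι)) (A : Matrix κ ι ℝ) :
    Matrix κ ι ℝ := by
  classical exact Matrix.of fun i j => if (i, j) ∈ J then A i j else 0

lemma restrictEntries_of_mem {κ ι : Type*} {J : Set (κ × ι)} {A : Matrix κ ι ℝ} {e : κ × ι}
    (he : e ∈ J) : restrictEntries J A e.1 e.2 = A e.1 e.2 := by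
  simp [restrictEntries, he]

lemma restrictEntries_of_notMem {κ ι : Type*} {J : Set (κ × ι)} {A : Matrix κ ι ℝ} {e : κ × ι}
    (he : e ∉ J) : restrictEntries J A e.1 e.2 = 0 := by
  simp [restrictEntries, he]

/-- In the symmetric case the two triangles are dependent, but each one separately has independent
entries. Bounding their operator norms one by one treats both initializations at once. -/
lemma restrictEntries_add_restrictEntries (A : Matrix (Fin h) (Fin h) ℝ) :
    restrictEntries {q | q.1 ≤ q.2} A + restrictEntries {q | q.2 < q.1} A = A := by
  ext i j
  rcases le_or_gt i j with hij | hij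
  · simp [restrictEntries, hij, not_lt.2 hij]
  · simp [restrictEntries, hij, not_le.2 hij]

lemma measure_lt_opNorm_restrictEntries_le [IsProbabilityMeasure P] {m k N : ℕ}
    {X : Ω → Matrix (Fin m) (Fin k) ℝ} {J : Set (Fin m × Fin k)} {K : ℝ} (hN : 0 < N) (hK : 0 ≤ K)
    (hcard : ((m + k : ℕ) : ℝ) ≤ K * N)
    (hind : iIndepFun (fun (e : J) ω => X ω e.1.1 e.1.2) P)
    (hlaw : ∀ i j, HasLaw (fun ω => √N * X ω i j) (gaussianReal 0 1) P) :
    P {ω | 4 * √(2 * (2 * K + 1)) < opNorm (restrictEntries J (X ω))} ≤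
      ENNReal.ofReal (Real.exp (-N)) := by
  have he : ∀ (e : J) ω, restrictEntries J (X ω) e.1.1 e.1.2 = X ω e.1.1 e.1.2 := fun e ω =>
    restrictEntries_of_mem e.2
  refine measure_lt_opNorm_gaussian_le hN hK (by simpa using hcard) (J := J)
    (by simp_rw [he]; exact hind) (fun e heJ => ?_) fun ω e heJ => restrictEntries_of_notMem heJ
  simp_rw [restrictEntries_of_mem heJ]
  exact hlaw _ _

/-- Union bound over seven bad events: large operator norm of the encoder or of either triangle of
the head, and failed concentration of `x₀`, of `Φ x₀`, of the upper triangle of `W`, or of `W Φ`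
given `W`. The factor `2` in `hM'` accounts for the two triangles. -/
lemma measure_not_isTypicalInit_le [IsProbabilityMeasure P] {K M η : ℝ} (hd : 0 < d) (hh : 0 < h)
    (hη : 0 < η) (hK : ((h + d : ℕ) : ℝ) ≤ K * d)
    (hM : 4 * √(2 * (2 * K + 1)) ≤ M) (hM' : 2 * (4 * √(2 * (2 * 2 + 1))) ≤ M)
    (hinit : IsIIDInit P Φ W x₀ ∨ IsSymmetricInit P Φ W x₀) :
    P {ω | ¬ IsTypicalInit M η (Φ ω) (W ω) (x₀ ω)} ≤
      ENNReal.ofReal (Real.exp (-d) + 2 * Real.exp (-h) + 8 / d + 8 * M ^ 2 / (η ^ 2 * h) +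
        512 / h ^ 2 + 8 * M ^ 2 / d) := by
  have hd' : (0 : ℝ) < d := Nat.cast_pos.2 hd
  have hh' : (0 : ℝ) < h := Nat.cast_pos.2 hh
  have hsd : 0 < √(d : ℝ) := Real.sqrt_pos.2 hd'
  have hsh : 0 < √(h : ℝ) := Real.sqrt_pos.2 hh'
  have hK0 : 0 ≤ K := le_of_mul_le_mul_right (by rw [zero_mul]; exact (Nat.cast_nonneg _).trans hK) hd'
  obtain ⟨hg, hlow, hWΦ⟩ := indep_of_init hinit
  have hmΦ : AEMeasurable (fun ω (p : Fin h × Fin d) => Φ ω p.1 p.2) P :=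
    aemeasurable_pi_iff.2 fun p => hg.aemeasurable_encoder _ _
  have hmW : AEMeasurable (fun ω (q : Fin h × Fin h) => W ω q.1 q.2) P :=
    aemeasurable_pi_iff.2 fun p => hg.aemeasurable_head _ _
  have hmx : AEMeasurable x₀ P := aemeasurable_pi_iff.2 fun j => (hg.law_x₀ j).aemeasurable
  have b1 : P {ω | 4 * √(2 * (2 * K + 1)) < opNorm (Φ ω)} ≤ ENNReal.ofReal (Real.exp (-d)) := by
    have := measure_lt_opNorm_restrictEntries_le (J := Set.univ) hd hK0 hK
      (hg.iIndepFun_encoder.precomp Subtype.val_injective) hg.law_Φ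
    simpa [restrictEntries, ← Matrix.ext_iff, show ∀ A : Matrix (Fin h) (Fin d) ℝ,
      (Matrix.of fun i j => A i j) = A from fun A => rfl] using this
  have hh2 : ((h + h : ℕ) : ℝ) ≤ 2 * h := by push_cast; linarith
  have b2 := measure_lt_opNorm_restrictEntries_le hh zero_le_two hh2 hg.iIndepFun_head hg.law_W
  have b3 := measure_lt_opNorm_restrictEntries_le hh zero_le_two hh2 hlow hg.law_W
  have b4 := measure_le_abs_vecNorm_sub_sqrt_card_le hmx hg.map_input hsd
  have b5 := measure_opNorm_le_and_le_abs_sub_le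
    (A := fun v : Fin h × Fin d → ℝ => (Matrix.of fun i j => v (i, j) : Matrix (Fin h) (Fin d) ℝ))
    (by fun_prop) hmΦ hmx hg.indepFun_encoder_input hg.map_input M (mul_pos hη hsh)
  have b6 : P {ω | (h : ℝ) / 8 ≤
      |vecNorm (fun q : {q : Fin h × Fin h | q.1 ≤ q.2} => √h * W ω q.1.1 q.1.2) -
        √(Fintype.card {q : Fin h × Fin h | q.1 ≤ q.2})|} ≤ ENNReal.ofReal (8 / (h / 8) ^ 2) :=
    measure_le_abs_vecNorm_sub_sqrt_card_le
      (aemeasurable_pi_iff.2 fun q => (hg.law_W _ _).aemeasurable)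
      (map_eq_stdGauss (hg.iIndepFun_head.comp (fun _ x => √h * x) fun _ => by fun_prop)
        fun q => hg.law_W q.1.1 q.1.2) (by positivity)
  have hind7 : IndepFun (fun ω (q : Fin h × Fin h) => W ω q.1 q.2)
      (fun ω (p : Fin h × Fin d) => √d * Φ ω p.1 p.2) P :=
    hWΦ.comp (φ := id) (ψ := fun (v : Fin h × Fin d → ℝ) p => √d * v p) measurable_id
      (by fun_prop)
  have b7 := measure_opNorm_le_and_le_abs_sub_le
    (A := fun v : Fin h × Fin h → ℝ =>
      mulLeftMatrix d (Matrix.of fun i j => v (i, j) : Matrix (Fin h) (Fin h) ℝ))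
    (G := fun ω (p : Fin h × Fin d) => √d * Φ ω p.1 p.2)
    (by
      refine continuous_pi fun p => continuous_pi fun q => ?_
      by_cases hpq : p.2 = q.2
      · simp only [mulLeftMatrix, of_apply, hpq, if_true]; fun_prop
      · simp only [mulLeftMatrix, of_apply, hpq, if_false]; fun_prop) hmW
    (aemeasurable_pi_iff.2 fun p => (hg.law_Φ _ _).aemeasurable)
    hind7 hg.map_encoder M hsd
  set B1 := {ω | 4 * √(2 * (2 * K + 1)) < opNorm (Φ ω)}
  set B2 := {ω | 4 * √(2 * (2 * 2 + 1)) < opNorm (restrictEntries {q | q.1 ≤ q.2} (W ω))}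
  set B3 := {ω | 4 * √(2 * (2 * 2 + 1)) < opNorm (restrictEntries {q | q.2 < q.1} (W ω))}
  set B4 := {ω | √(d : ℝ) ≤ |vecNorm (x₀ ω) - √(Fintype.card (Fin d))|}
  set B5 := {ω | opNorm (Φ ω) ≤ M ∧ η * √h ≤ |vecNorm (Φ ω *ᵥ x₀ ω) - matNorm (Φ ω)|}
  set B6 := {ω | (h : ℝ) / 8 ≤
      |vecNorm (fun q : {q : Fin h × Fin h | q.1 ≤ q.2} => √h * W ω q.1.1 q.1.2) -
        √(Fintype.card {q : Fin h × Fin h | q.1 ≤ q.2})|}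
  set B7 := {ω | opNorm (mulLeftMatrix d (W ω)) ≤ M ∧ √(d : ℝ) ≤
    |vecNorm (mulLeftMatrix d (W ω) *ᵥ fun p : Fin h × Fin d => √d * Φ ω p.1 p.2) -
      matNorm (mulLeftMatrix d (W ω))|}
  have hsub : {ω | ¬ IsTypicalInit M η (Φ ω) (W ω) (x₀ ω)} ⊆
      B1 ∪ (B2 ∪ (B3 ∪ (B4 ∪ (B5 ∪ (B6 ∪ B7))))) := by
    intro ω hω
    by_contra hcon
    simp only [Set.mem_union, not_or] at hcon
    obtain ⟨n1, n2, n3, n4, n5, n6, n7⟩ := hcon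
    refine hω ?_
    have hΦM : opNorm (Φ ω) ≤ M := (not_lt.1 n1).trans hM
    have hWM : opNorm (W ω) ≤ M := by
      have := opNorm_add_le (restrictEntries {q | q.1 ≤ q.2} (W ω))
        (restrictEntries {q | q.2 < q.1} (W ω))
      rw [restrictEntries_add_restrictEntries] at this
      have m2 : opNorm (restrictEntries {q | q.1 ≤ q.2} (W ω)) ≤ _ := not_lt.1 n2
      have m3 : opNorm (restrictEntries {q | q.2 < q.1} (W ω)) ≤ _ := not_lt.1 n3
      linarith
    refine ⟨hΦM, hWM, ?_, ?_, ?_⟩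
    · have m4 : |vecNorm (x₀ ω) - √(Fintype.card (Fin d))| < √d := not_le.1 n4
      have := (abs_lt.1 m4).2
      rw [Fintype.card_fin] at this
      linarith
    · exact (not_le.1 fun h' => n5 ⟨hΦM, h'⟩).le
    · have n6' : |vecNorm (fun q : {q : Fin h × Fin h | q.1 ≤ q.2} => √h * W ω q.1.1 q.1.2) -
          √(Fintype.card {q : Fin h × Fin h | q.1 ≤ q.2})| < h / 8 := not_le.1 n6
      have m6 := (abs_lt.1 n6').1
      have m7 := (abs_lt.1 (not_le.1 fun h' =>
        n7 ⟨(opNorm_mulLeftMatrix_le _).trans hWM, h'⟩)).1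
      have e7 : vecNorm (mulLeftMatrix d (W ω) *ᵥ fun p : Fin h × Fin d => √d * Φ ω p.1 p.2) =
          √d * matNorm (W ω * Φ ω) := by
        rw [vecNorm_mulLeftMatrix_mulVec]
        have : (Matrix.of fun i j => √d * Φ ω i j : Matrix (Fin h) (Fin d) ℝ) = √d • Φ ω := rfl
        rw [this, Matrix.mul_smul, matNorm_smul, abs_of_pos hsd]
      rw [e7, matNorm_mulLeftMatrix] at m7
      have m8 : matNorm (W ω) - 1 < matNorm (W ω * Φ ω) :=
        lt_of_mul_lt_mul_left (by linarith) hsd.le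
      have m9 : vecNorm (fun q : {q : Fin h × Fin h | q.1 ≤ q.2} => √h * W ω q.1.1 q.1.2) ≤
          √h * matNorm (W ω) := by
        refine abs_le_of_sq_le_sq' ?_ (mul_nonneg hsh.le (matNorm_nonneg _)) |>.2
        rw [vecNorm_sq, mul_pow, matNorm_sq, ← Fintype.sum_prod_type', Finset.mul_sum]
        simp_rw [mul_pow]
        rw [← Finset.sum_subtype (Finset.univ.filter fun q : Fin h × Fin h => q.1 ≤ q.2) (by simp)
          fun q : Fin h × Fin h => √(h : ℝ) ^ 2 * W ω q.1 q.2 ^ 2]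
        exact Finset.sum_le_sum_of_subset_of_nonneg (Finset.filter_subset _ _)
              fun _ _ _ => by positivity
      -- Since `1 / √2 ≥ 5 / 8`, subtracting the allowed deviation `h / 8` leaves `√h ‖W‖_F ≥ h /
      -- 2`. The `-1` in `norm_product` comes from the deviation `√d` in `m7`.
      have m10 : (5 / 8 : ℝ) * h ≤ √(Fintype.card {q : Fin h × Fin h | q.1 ≤ q.2}) := by
        refine Real.le_sqrt_of_sq_le ?_
        have := sq_le_two_mul_card_le h
        nlinarith
      have m11 : √(h : ℝ) * (√h / 2) ≤ √h * matNorm (W ω) := by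
        have : √(h : ℝ) * √h = h := Real.mul_self_sqrt hh'.le
        linarith
      have m12 := le_of_mul_le_mul_left m11 hsh
      linarith
  calc _ ≤ P (B1 ∪ (B2 ∪ (B3 ∪ (B4 ∪ (B5 ∪ (B6 ∪ B7)))))) := measure_mono hsub
    _ ≤ P B1 + (P B2 + (P B3 + (P B4 + (P B5 + (P B6 + P B7))))) := by
        repeat' first
          | exact le_rfl
          | refine (measure_union_le _ _).trans (add_le_add le_rfl ?_)
    _ ≤ ENNReal.ofReal (Real.exp (-d)) + (ENNReal.ofReal (Real.exp (-h)) +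
        (ENNReal.ofReal (Real.exp (-h)) + (ENNReal.ofReal (8 / √d ^ 2) +
        (ENNReal.ofReal (8 * M ^ 2 / (η * √h) ^ 2) + (ENNReal.ofReal (8 / (h / 8) ^ 2) +
          ENNReal.ofReal (8 * M ^ 2 / √d ^ 2)))))) :=
        add_le_add b1 (add_le_add b2 (add_le_add b3 (add_le_add b4 (add_le_add b5
          (add_le_add b6 b7)))))
    _ = _ := by
        repeat rw [← ENNReal.ofReal_add (by positivity) (by positivity)]
        rw [mul_pow, Real.sq_sqrt hd'.le, Real.sq_sqrt hh'.le]
        congr 1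
        field_simp
        ring

end Initialization

/-! ### Transfer from time zero to time `t`. -/

section Conclusion

/-- Both norms are Lipschitz in the matrix. The bound is deterministic, so the matrix at time `t`
may depend on `x` in any way. -/
lemma abs_vecNorm_mulVec_sub_matNorm_le {ι κ : Type*} [Fintype ι] [Fintype κ]
    (A B : Matrix κ ι ℝ) (x : ι → ℝ) :
    |vecNorm (A *ᵥ x) - matNorm A| ≤
      |vecNorm (B *ᵥ x) - matNorm B| + matNorm (A - B) * (vecNorm x + 1) := by
  have h1 := (abs_vecNorm_sub_le (A *ᵥ x) (B *ᵥ x)).trans_eq (by rw [← sub_mulVec])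
  have h2 := h1.trans (vecNorm_mulVec_le_matNorm (A - B) x)
  have h3 := abs_matNorm_sub_le A B
  rw [abs_le] at h2 h3
  have h4 := abs_le.1 (le_refl |vecNorm (B *ᵥ x) - matNorm B|)
  rw [abs_le]
  constructor <;> linarith [h4.1, h4.2, h2.1, h2.2, h3.1, h3.2]

variable {d h : ℕ}

lemma abs_sub_encoder_le {M η δ r : ℝ} (hr : 1 ≤ r) {Φ₀ Φ : Matrix (Fin h) (Fin d) ℝ}
    {W₀ : Matrix (Fin h) (Fin h) ℝ} {x₀ : Fin d → ℝ} (hδ : 0 ≤ δ)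
    (hinit : IsTypicalInit M η Φ₀ W₀ x₀) (hΦ : matNorm (r • Φ - Φ₀) ≤ δ) :
    |vecNorm (Φ *ᵥ x₀) - matNorm Φ| ≤ η * √h + δ * (2 * √d + 1) := by
  have hr0 : 0 < r := by linarith
  -- The quantity is homogeneous in `Φ`, so undoing the decay, that is multiplying by `r ≥ 1`, only
  -- enlarges it.
  have h1 : |vecNorm (Φ *ᵥ x₀) - matNorm Φ| ≤
      |vecNorm ((r • Φ) *ᵥ x₀) - matNorm (r • Φ)| := by
    rw [smul_mulVec, vecNorm_smul, matNorm_smul, ← mul_sub, abs_mul, abs_abs, abs_of_pos hr0]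
    exact le_mul_of_one_le_left (abs_nonneg _) hr
  refine h1.trans ((abs_vecNorm_mulVec_sub_matNorm_le _ Φ₀ x₀).trans
    (add_le_add hinit.norm_image ?_))
  exact mul_le_mul hΦ (by linarith [hinit.norm_input]) (by linarith [vecNorm_nonneg x₀]) hδ

/-- No cancellation is used: `|W Φ x₀|` and `‖W Φ‖_F` are at most `2 (M + 1)² √d` and `(M + 1)² √d`
respectively. -/
lemma abs_sub_product_le {M η r : ℝ} (hr : 1 ≤ r) {Φ₀ Φ : Matrix (Fin h) (Fin d) ℝ}
    {W₀ W : Matrix (Fin h) (Fin h) ℝ} {x₀ : Fin d → ℝ}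
    (hinit : IsTypicalInit M η Φ₀ W₀ x₀) (hΦ : matNorm (r • Φ - Φ₀) ≤ 1)
    (hW : matNorm (r • W - W₀) ≤ 1) :
    |vecNorm ((W * Φ) *ᵥ x₀) - matNorm (W * Φ)| ≤ 3 * (M + 1) ^ 2 * √d := by
  have hr0 : 0 < r := by linarith
  have bound : ∀ {κ ι : Type} [Fintype κ] [Fintype ι] {A A₀ : Matrix κ ι ℝ}, opNorm A₀ ≤ M →
      matNorm (r • A - A₀) ≤ 1 → opNorm A ≤ M + 1 := fun {κ ι} _ _ {A A₀} hA₀ hA => by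
    have h2 := opNorm_smul_le r⁻¹ (r • A)
    rw [smul_smul, inv_mul_cancel₀ hr0.ne', one_smul, abs_of_pos (inv_pos.2 hr0)] at h2
    exact h2.trans ((mul_le_of_le_one_left (opNorm_nonneg _) (inv_le_one_of_one_le₀ hr)).trans
      (opNorm_le_of_matNorm_sub_le hA₀ hA))
  have hW1 := bound hinit.opNorm_head hW
  have hop : opNorm (W * Φ) ≤ (M + 1) ^ 2 := by
    refine (opNorm_mul_le _ _).trans ?_
    rw [sq]
    exact mul_le_mul hW1 (bound hinit.opNorm_encoder hΦ) (opNorm_nonneg _)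
      ((opNorm_nonneg _).trans hW1)
  have h1 : vecNorm ((W * Φ) *ᵥ x₀) ≤ (M + 1) ^ 2 * (2 * √d) :=
    (vecNorm_mulVec_le _ _).trans
      (mul_le_mul hop hinit.norm_input (vecNorm_nonneg _) (sq_nonneg _))
  have h2 : matNorm (W * Φ) ≤ (M + 1) ^ 2 * √d := by
    refine abs_le_of_sq_le_sq' ?_ (by positivity) |>.2
    refine (matNorm_sq_le_card_mul _).trans ?_
    rw [mul_pow, Real.sq_sqrt (Nat.cast_nonneg _), Fintype.card_fin, mul_comm]
    exact mul_le_mul_of_nonneg_right (pow_le_pow_left₀ (opNorm_nonneg _) hop 2)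
      (Nat.cast_nonneg _)
  rw [abs_le]
  have h3 := vecNorm_nonneg ((W * Φ) *ᵥ x₀)
  have h4 := matNorm_nonneg (W * Φ)
  have h5 : 0 ≤ (M + 1) ^ 2 * √(d : ℝ) := by positivity
  constructor <;> linarith

lemma abs_l2Norm_smul_sub_frobNorm_smul {c : ℝ} (hc : 0 ≤ c) (A : Matrix (Fin h) (Fin d) ℝ)
    (x : Fin d → ℝ) :
    |l2Norm ((c • A) *ᵥ x) - frobNorm (c • A)| = c * |vecNorm (A *ᵥ x) - matNorm A| := by
  rw [l2Norm_eq_vecNorm, frobNorm_eq_matNorm, smul_mulVec, vecNorm_smul, matNorm_smul, ← mul_sub,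
    abs_mul, abs_abs, abs_of_nonneg hc]

/-- For wide networks, the flow started at a typical point stays close to its initial value. -/
lemma eventually_close_of_flow {ρ t M : ℝ} (hρ : 0 < ρ) (ht : 0 ≤ t) {δ : ℝ}
    (hδ : 0 < δ) (hδ1 : δ ≤ 1) :
    ∀ᶠ h : ℕ in atTop, ∀ (d : ℕ) (σ η : ℝ) (S : Submodule ℝ (Matrix (Fin h) (Fin h) ℝ))
      (Φ : ℝ → Matrix (Fin h) (Fin d) ℝ) (W : ℝ → Matrix (Fin h) (Fin h) ℝ) (x₀ : Fin d → ℝ),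
      IsGradientFlow σ ρ S t Φ W → IsTypicalInit M η (Φ 0) (W 0) x₀ →
      matNorm (Real.exp (ρ * t) • Φ t - Φ 0) ≤ δ ∧
        matNorm (Real.exp (ρ * t) • W t - W 0) ≤ δ := by
  have hlin : Tendsto (fun h : ℕ => √(h : ℝ) / 2 - 1 - (2 * M + 1)) atTop atTop := by
    have h1 : Tendsto (fun h : ℕ => √(h : ℝ)) atTop atTop :=
      Real.tendsto_sqrt_atTop.comp tendsto_natCast_atTop_atTop
    exact tendsto_atTop_add_const_right _ _ (tendsto_atTop_add_const_right _ _
      (h1.atTop_div_const two_pos))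
  have hQ : Tendsto (fun h : ℕ => (√(h : ℝ) / 2 - 1 - (2 * M + 1)) ^ 2 - 2 * (M + 1) ^ 4)
      atTop atTop :=
    tendsto_atTop_add_const_right _ _ ((tendsto_pow_atTop two_ne_zero).comp hlin)
  -- The lower bound `√h / 2 - 1` on `‖W Φ‖_F` at time zero makes the speed of the rescaled flow
  -- `O(1 / √h)`, uniformly in `d`, `σ` and the constraint space.
  have hslope : Tendsto (fun h : ℕ => 2 * Real.exp (2 * ρ * t) * (M + 1) *
      (√((√(h : ℝ) / 2 - 1 - (2 * M + 1)) ^ 2 - 2 * (M + 1) ^ 4))⁻¹) atTop (𝓝 0) := by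
    simpa using (tendsto_inv_atTop_zero.comp (Real.tendsto_sqrt_atTop.comp hQ)).const_mul
      (2 * Real.exp (2 * ρ * t) * (M + 1))
  have hpos : 0 < δ / (t + 1) := by positivity
  filter_upwards [hlin.eventually_ge_atTop 0, hQ.eventually_gt_atTop 0,
    hslope.eventually_lt_const hpos] with h h1 h2 h3 d σ η S Φ W x₀ hflow hinit
  have hF := hinit.norm_product
  refine hflow.matNorm_exp_smul_sub_le hρ ht hδ hδ1 hinit.opNorm_encoder hinit.opNorm_head
    (by linarith) h2 ?_ h3 t (Set.right_mem_Icc.2 ht)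
  have := pow_le_pow_left₀ h1 (sub_le_sub_right hF (2 * M + 1)) 2
  linarith

end Conclusion

theorem mainTheorem5
    (σ ρ α : ℝ) (hσ : 0 < σ) (hρ : 0 < ρ) (hα : 0 < α)
    -- the proportional limit
    (d h : ℕ → ℕ) (hd : Tendsto d atTop atTop) (hh : Tendsto h atTop atTop)
    (hdh : Tendsto (fun n => (d n : ℝ) / (h n : ℝ)) atTop (𝓝 α))
    {Ω : ℕ → Type*} [∀ n, MeasurableSpace (Ω n)]
    (P : ∀ n, Measure (Ω n)) [∀ n, IsProbabilityMeasure (P n)]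
    (Φ : ∀ n, Ω n → ℝ → Matrix (Fin (h n)) (Fin (d n)) ℝ)
    (W : ∀ n, Ω n → ℝ → Matrix (Fin (h n)) (Fin (h n)) ℝ)
    (x₀ : ∀ n, Ω n → Fin (d n) → ℝ)
    -- Gaussian input and Gaussian initialization (independent entries, or symmetric `W`)
    (hinit : ∀ n,
      IsIIDInit (P n) (fun ω => Φ n ω 0) (fun ω => W n ω 0) (x₀ n) ∨
      IsSymmetricInit (P n) (fun ω => Φ n ω 0) (fun ω => W n ω 0) (x₀ n))
    -- the head is unconstrained or ranges over the symmetric matrices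
    (S : ∀ n, Submodule ℝ (Matrix (Fin (h n)) (Fin (h n)) ℝ))
    (hS : ∀ n, S n = ⊤ ∨ S n = symMatrices (h n))
    (t : ℝ) (ht : 0 ≤ t)
    -- up to time `t` the parameters follow the gradient flow (with probability tending to one)
    (hflow : Tendsto (fun n => P n {ω | ¬ IsGradientFlow σ ρ (S n) t (Φ n ω) (W n ω)})
      atTop (𝓝 0)) :
    IsLittleOP P (fun n ω =>
      l2Norm (((1 / Real.sqrt (h n * σ ^ 2)) • Φ n ω t) *ᵥ x₀ n ω)
        - frobNorm ((1 / Real.sqrt (h n * σ ^ 2)) • Φ n ω t)) ∧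
    IsLittleOP P (fun n ω =>
      l2Norm (((1 / Real.sqrt ((h n : ℝ) ^ 2 * σ ^ 2)) • (W n ω t * Φ n ω t)) *ᵥ x₀ n ω)
        - frobNorm ((1 / Real.sqrt ((h n : ℝ) ^ 2 * σ ^ 2)) • (W n ω t * Φ n ω t))) := by
  -- Eventually `d / h > α / 2`, hence `h + d ≤ K d`; likewise `d ≤ K' h`, because `α < K'`.
  set K : ℝ := 1 + 2 / α with hK
  set K' : ℝ := α + 1 with hK'
  have hK'0 : 0 < K' := by positivity
  set M : ℝ := max (4 * √(2 * (2 * K + 1))) (2 * (4 * √(2 * (2 * 2 + 1)))) with hM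
  have hd1 : ∀ᶠ n in atTop, 0 < d n := hd.eventually_gt_atTop 0
  have hh1 : ∀ᶠ n in atTop, 0 < h n := hh.eventually_gt_atTop 0
  have hhd : ∀ᶠ n in atTop, ((h n + d n : ℕ) : ℝ) ≤ K * d n := by
    filter_upwards [hdh.eventually_const_lt (show α / 2 < α by linarith), hh1] with n hn hn'
    have hn0 : (0 : ℝ) < h n := Nat.cast_pos.2 hn'
    rw [lt_div_iff₀ hn0] at hn
    have : (h n : ℝ) ≤ 2 / α * d n := by
      rw [div_mul_eq_mul_div, le_div_iff₀ hα]; linarith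
    push_cast
    rw [hK]; linarith
  have hdK' : ∀ᶠ n in atTop, √(d n : ℝ) ≤ √K' * √(h n) := by
    filter_upwards [hdh.eventually_lt_const (show α < K' by linarith), hh1] with n hn hn'
    have hn0 : (0 : ℝ) < h n := Nat.cast_pos.2 hn'
    rw [div_lt_iff₀ hn0] at hn
    rw [← Real.sqrt_mul hK'0.le]
    exact Real.sqrt_le_sqrt hn.le
  have hdR : Tendsto (fun n => (d n : ℝ)) atTop atTop := tendsto_natCast_atTop_atTop.comp hd
  have hhR : Tendsto (fun n => (h n : ℝ)) atTop atTop := tendsto_natCast_atTop_atTop.comp hh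
  -- reduction to the event that the flow starts at a typical point
  have reduction : ∀ (X : ∀ n, Ω n → ℝ) (ε η : ℝ), 0 < η →
      (∀ᶠ n in atTop, ∀ ω, IsGradientFlow σ ρ (S n) t (Φ n ω) (W n ω) →
        IsTypicalInit M η (Φ n ω 0) (W n ω 0) (x₀ n ω) → |X n ω| < ε) →
      Tendsto (fun n => P n {ω | ε ≤ |X n ω|}) atTop (𝓝 0) := by
    intro X ε η hη hX
    have hreal : Tendsto (fun n => Real.exp (-d n) + 2 * Real.exp (-h n) + 8 / (d n : ℝ) +
        8 * M ^ 2 / (η ^ 2 * h n) + 512 / (h n : ℝ) ^ 2 + 8 * M ^ 2 / d n) atTop (𝓝 0) := by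
      have e1 := Real.tendsto_exp_neg_atTop_nhds_zero.comp hdR
      have e2 := (Real.tendsto_exp_neg_atTop_nhds_zero.comp hhR).const_mul 2
      have e3 := hdR.const_div_atTop 8
      have e4 := (hhR.const_mul_atTop (pow_pos hη 2)).const_div_atTop (8 * M ^ 2)
      have e5 := ((tendsto_pow_atTop two_ne_zero).comp hhR).const_div_atTop 512
      have e6 := hdR.const_div_atTop (8 * M ^ 2)
      simpa using ((((e1.add e2).add e3).add e4).add e5).add e6
    have hsum := hflow.add (ENNReal.tendsto_ofReal hreal)
    rw [ENNReal.ofReal_zero, add_zero] at hsum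
    refine tendsto_of_tendsto_of_tendsto_of_le_of_le' tendsto_const_nhds hsum
      (Eventually.of_forall fun n => zero_le) ?_
    filter_upwards [hX, hd1, hh1, hhd] with n hXn hdn hhn hhdn
    refine le_trans (measure_mono ?_) ((measure_union_le _ _).trans (add_le_add le_rfl
      (measure_not_isTypicalInit_le (K := K) (M := M) hdn hhn hη hhdn (le_max_left _ _)
        (le_max_right _ _) (hinit n))))
    intro ω hω
    by_contra hcon
    rw [Set.mem_union, not_or] at hcon
    exact absurd (hXn ω (not_not.1 hcon.1) (not_not.1 hcon.2)) (not_lt.2 hω)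
  have hr : 1 ≤ Real.exp (ρ * t) := Real.one_le_exp (mul_nonneg hρ.le ht)
  constructor
  · intro ε hε
    -- The error `η √h + δ (2 √d + 1)` has to stay below `σ ε √h`. With `2 √d + 1 ≤ (2 √K' + 1) √h`,
    -- this `δ` and `η = σ ε / 4` give each term at most a quarter of it.
    set δ : ℝ := min 1 (σ * ε / (4 * (2 * √K' + 1))) with hδ
    have hδ0 : 0 < δ := lt_min one_pos (by positivity)
    refine reduction _ ε (σ * ε / 4) (by positivity) ?_
    filter_upwards [hh.eventually (eventually_close_of_flow (M := M) hρ ht hδ0 (min_le_left _ _)),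
      hh1, hdK'] with n hclose hhn hdn ω hf hi
    have hX := abs_sub_encoder_le hr hδ0.le hi (hclose _ _ _ _ _ _ _ hf hi).1
    have hs0 : 0 < √(h n : ℝ) := Real.sqrt_pos.2 (Nat.cast_pos.2 hhn)
    have hs1 : 1 ≤ √(h n : ℝ) := Real.one_le_sqrt.2 (by exact_mod_cast hhn)
    rw [abs_l2Norm_smul_sub_frobNorm_smul (by positivity), Real.sqrt_mul (Nat.cast_nonneg _),
      Real.sqrt_sq hσ.le, div_mul_eq_mul_div, one_mul, div_lt_iff₀ (by positivity)]
    have hδ' : δ * (2 * √K' + 1) ≤ σ * ε / 4 := by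
      have := min_le_right 1 (σ * ε / (4 * (2 * √K' + 1)))
      calc δ * (2 * √K' + 1) ≤ σ * ε / (4 * (2 * √K' + 1)) * (2 * √K' + 1) :=
            mul_le_mul_of_nonneg_right this (by positivity)
        _ = _ := by field_simp
    calc _ ≤ σ * ε / 4 * √(h n) + δ * (2 * √(d n) + 1) := hX
      _ ≤ σ * ε / 4 * √(h n) + δ * ((2 * √K' + 1) * √(h n)) := by
          refine add_le_add le_rfl (mul_le_mul_of_nonneg_left ?_ hδ0.le)
          linarith
      _ ≤ σ * ε / 4 * √(h n) + σ * ε / 4 * √(h n) := by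
          rw [← mul_assoc]
          exact add_le_add le_rfl (mul_le_mul_of_nonneg_right hδ' hs0.le)
      _ < ε * (√(h n) * σ) := by
          have : 0 < σ * ε * √(h n) := by positivity
          linarith
  · intro ε hε
    -- The crude bound ignores concentration of `Φ x₀`, so any `η` serves, and closeness `1` is
    -- enough.
    refine reduction _ ε 1 one_pos ?_
    have hlim : Tendsto (fun n => √(h n : ℝ)) atTop atTop := Real.tendsto_sqrt_atTop.comp hhR
    filter_upwards [hh.eventually (eventually_close_of_flow (M := M) hρ ht one_pos le_rfl),
      hh1, hdK', hlim.eventually_gt_atTop (3 * (M + 1) ^ 2 * √K' / (ε * σ))]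
      with n hclose hhn hdn hbig ω hf hi
    obtain ⟨hcΦ, hcW⟩ := hclose _ _ _ _ _ _ _ hf hi
    have hX := abs_sub_product_le hr hi hcΦ hcW
    have hn0 : (0 : ℝ) < h n := Nat.cast_pos.2 hhn
    have hs0 : 0 < √(h n : ℝ) := Real.sqrt_pos.2 hn0
    rw [abs_l2Norm_smul_sub_frobNorm_smul (by positivity), Real.sqrt_mul (sq_nonneg _),
      Real.sqrt_sq hσ.le, Real.sqrt_sq hn0.le, div_mul_eq_mul_div, one_mul,
      div_lt_iff₀ (by positivity)]
    rw [div_lt_iff₀ (by positivity)] at hbig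
    calc _ ≤ 3 * (M + 1) ^ 2 * √(d n) := hX
      _ ≤ 3 * (M + 1) ^ 2 * (√K' * √(h n)) := mul_le_mul_of_nonneg_left hdn (by positivity)
      _ = (3 * (M + 1) ^ 2 * √K') * √(h n) := by ring
      _ < √(h n) * (ε * σ) * √(h n) := mul_lt_mul_of_pos_right hbig hs0
      _ = ε * (√(h n) ^ 2 * σ) := by ring
      _ = ε * (h n * σ) := by rw [Real.sq_sqrt hn0.le]
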